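/- All rings are commutative with unit. Let $\mathrm{Alg}^{\mathrm{fl}}$ be the category of faithfully flat finite type algebras $h\colon S\to R$ of noetherian rings; an arrow $(S_1\to R_1)\to(S_2\to R_2)$ is a commutative square of ring homomorphisms $S_1\to S_2$, $R_1\to R_2$ with $R_1\otimes_{S_1}S_2\to R_2$ an isomorphism. Let $\mathrm{mod}^{\mathrm{fl}}$ be the category of pairs $(h\colon S\to R,N)$ with $h$ in $\mathrm{Alg}^{\mathrm{fl}}$ and $N$ an $S$-flat finite $R$-module; an arrow is an arrow of $\mathrm{Alg}^{\mathrm{fl}}$ together with an $(R_1\to R_2)$-linear map $N_1\to N_2$. For $n\ge 1$, a module $M$ over a ring $A$ is $n$-stably reflexive if it is reflexive and $\mathrm{Ext}^i_A(M,A)=0=\mathrm{Ext}^i_A(M^*,A)$ for $0<i<n$. An $R$-module $M$ is $n$-stably reflexive with respect to $h\colon S\to R$ if it is $S$-flat and $M\otimes_S k(s)$ is an $n$-stably reflexive $R\otimes_S k(s)$-module for every $s$ in the image of the closed points of $\operatorname{Spec}R$ in $\operatorname{Spec}S$. Define full subcategories of $\mathrm{mod}^{\mathrm{fl}}$ by conditions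 on $(h,N)$: $\hat{P}^{\mathrm{fl}}(n)$: $N$ has projective dimension $\le n$ over $R$; $X(r)$: $N$ is $r$-stably reflexive with respect to $h$; $Y(r,s)$: $N\cong\bigoplus_i N_i$ such that for each $i$ the syzygy $\Omega_R^{n_i}N_i$ (formed with finite projective modules) is $(r+n_i)$-stably reflexive with respect to $h$ for some $0\le n_i<s$. A subscript $h$ denotes the fibre over $h$; these fibres are defined in the same way for any flat homomorphism $h$ of noetherian local rings. For a full subcategory $X$, a right $X$-approximation of $N$ is an arrow $\pi\colon M\to N$ with $M$ in $X$ through which every arrow $M'\to N$ with $M'$ in $X$ factors; it is minimal if $\pi\eta=\pi$ implies that $\eta\colon M\to M$ is an automorphism. Left approximations and their minimality are defined dually. A full subcategory $X$ of $Y$ is contravariantly (covariantly) finite in $Y$ if every object of $Y$ has a right (left) $X$-approximation. Theorem. Let $h\colon S\to R$ be in $\mathrm{Alg}^{\mathrm{fl}}$ and let $r,s>1$. (i) For every $N$ in $Y(r,s)_h$ there are short exact sequences of $R$-modules (a) $0\to L\to M\to N\to 0$ with $L$ in $\hat{P}^{\mathrm{fl}}(s-2)_h$ and $M$ in $X(r)_h$,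 (b) $0\to N\to L'\to M'\to 0$ with $L'$ in $\hat{P}^{\mathrm{fl}}(s-1)_h$ and $M'$ in $X(r-1)_h$, which are preserved by any base change $S\to S'$ of noetherian rings: the base-changed sequence is again short exact, its terms lie in the corresponding subcategories for $h'=h\otimes_S S'$, and $N\otimes_S S'$ is in $Y(r,s)_{h'}$. (ii) Let $N$ be in $Y(r,s)_h$. If $s\le r$, the map $M\to N$ in any sequence (a) is a right $X(r)$-approximation of $N$ in $\mathrm{mod}^{\mathrm{fl}}$. If $s\le r-2$, the map $N\to L'$ in any sequence (b) is a left $\hat{P}^{\mathrm{fl}}(s-1)$-approximation of $N$ in $\mathrm{mod}^{\mathrm{fl}}$. (iii) $X(r)$ is a contravariantly finite subcategory of $Y(r,r)$, and, if $r\ge 3$, $\hat{P}^{\mathrm{fl}}(r-3)$ is a covariantly finite subcategory of $Y(r,r-2)$. (iv) If $S$ and $R$ are local and $h$ is a local homomorphism, then for every $N$ in $Y(r,s)_h$ there is a sequence (a) as in (i) with $M\to N$ a minimal right $X(r)$-approximation if $s\le r$, and a sequence (b) as in (i) with $N\to L'$ a minimal left $\hat{P}^{\mathrm{fl}}(s-1)$-approximation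 if $s\le r-2$. The same holds for every flat local homomorphism $h$ of noetherian local rings, not necessarily of finite type, with approximations and minimality taken in the fibre category of $S$-flat finite $R$-modules and without the assertion about base change. -/

import Mathlib

open CategoryTheory TensorProduct

universe u

namespace FlatApprox

noncomputable section

/-! ### Reflexivity, absolute and relative -/

/-- `M` is `n`-stably reflexive over `A`: it is reflexive and
`Ext^i_A(M, A) = 0 = Ext^i_A(M^*, A)` for all `0 < i < n`. -/
def IsStablyReflexive {A : Type u} [CommRing A] (n : ℕ) (M : ModuleCat.{u} A) : Prop :=
  Module.IsReflexive A M ∧ ∀ i : ℕ, 0 < i → i < n →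
    Subsingleton (Abelian.Ext M (ModuleCat.of A A) i) ∧
    Subsingleton (Abelian.Ext (ModuleCat.of A (Module.Dual A M)) (ModuleCat.of A A) i)

/-- The `R`-module `N` is flat over `S` through `h : S → R`. -/
def IsFlatOver {S R : Type u} [CommRing S] [CommRing R] (h : S →+* R)
    (N : ModuleCat.{u} R) : Prop :=
  Module.Flat S ((ModuleCat.restrictScalars h).obj N)

/-- The fibre `N_s = N ⊗_S k(s)` at a point `s` of `Spec S`, with its natural structure of
module over `R_s = R ⊗_S k(s)`, in the form `R_s ⊗_R N`. -/
def fibre {S R : Type u} [CommRing S] [CommRing R] [Algebra S R]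
    (s : PrimeSpectrum S) (N : ModuleCat.{u} R) :
    ModuleCat.{u} (R ⊗[S] s.asIdeal.ResidueField) :=
  (ModuleCat.extendScalars
    (Algebra.TensorProduct.includeLeftRingHom : R →+* R ⊗[S] s.asIdeal.ResidueField)).obj N

/-- `N` is `n`-stably reflexive with respect to `h : S → R`: it is `S`-flat and its fibre
at each point in the image of the closed points of `Spec R` is `n`-stably reflexive. -/
def IsStablyReflexiveOver {S R : Type u} [CommRing S] [CommRing R] (n : ℕ) (h : S →+* R)
    (N : ModuleCat.{u} R) : Prop :=
  letI : Algebra S R := h.toAlgebra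
  IsFlatOver h N ∧
    ∀ s ∈ Set.range (fun m : MaximalSpectrum R => PrimeSpectrum.comap h m.toPrimeSpectrum),
      IsStablyReflexive n (fibre s N)

/-- `Z` is an `n`-th syzygy module of the `R`-module `N`, formed with finite projective
modules. -/
def IsSyzygy {R : Type u} [CommRing R] : ℕ → ModuleCat.{u} R → ModuleCat.{u} R → Prop
  | 0, N, Z => Nonempty (Z ≅ N)
  | n + 1, N, Z => ∃ (P : ModuleCat.{u} R) (p : P ⟶ N),
      Module.Finite R P ∧ Module.Projective R P ∧ Function.Surjective p ∧
        IsSyzygy n (ModuleCat.of R (LinearMap.ker p.hom)) Z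

/-! ### The module categories attached to `h : S → R` -/

/-- `mod^fl_h`: finite `R`-modules that are `S`-flat. -/
def modFlat {S R : Type u} [CommRing S] [CommRing R] (h : S →+* R) :
    ObjectProperty (ModuleCat.{u} R) :=
  fun N => Module.Finite R N ∧ IsFlatOver h N

/-- `P̂^fl(n)_h`: modules in `mod^fl_h` of `R`-projective dimension at most `n`. -/
def catP {S R : Type u} [CommRing S] [CommRing R] (n : ℕ) (h : S →+* R) :
    ObjectProperty (ModuleCat.{u} R) :=
  fun N => modFlat h N ∧ HasProjectiveDimensionLE N n

/-- `X(r)_h`: modules in `mod^fl_h` that are `r`-stably reflexive with respect to `h`. -/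
def catX {S R : Type u} [CommRing S] [CommRing R] (r : ℕ) (h : S →+* R) :
    ObjectProperty (ModuleCat.{u} R) :=
  fun N => modFlat h N ∧ IsStablyReflexiveOver r h N

/-- `Y(r, s)_h`: modules in `mod^fl_h` that are isomorphic to a direct sum of modules `N_i`,
each with an `n_i`-th syzygy that is `(r + n_i)`-stably reflexive with respect to `h`, for
some `0 ≤ n_i < s`. -/
def catY {S R : Type u} [CommRing S] [CommRing R] (r s : ℕ) (h : S →+* R) :
    ObjectProperty (ModuleCat.{u} R) :=
  fun N => modFlat h N ∧ ∃ (k : ℕ) (Ni : Fin k → ModuleCat.{u} R),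
    Nonempty (N ≃ₗ[R] DirectSum (Fin k) fun i => Ni i) ∧
    ∀ i, ∃ n < s, ∃ Z : ModuleCat.{u} R,
      IsSyzygy n (Ni i) Z ∧ IsStablyReflexiveOver (r + n) h Z

/-! ### The category of algebras and the category of modules over it -/

/-- Objects of `Alg^fl`: faithfully flat finite type algebras `h : S → R` of noetherian
rings. -/
structure AlgFl : Type (u + 1) where
  S : CommRingCat.{u}
  R : CommRingCat.{u}
  h : S ⟶ R
  noeth_S : IsNoetherianRing S
  noeth_R : IsNoetherianRing R
  faithfullyFlat : h.hom.FaithfullyFlat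
  finiteType : h.hom.FiniteType

/-- Arrows of `Alg^fl`: cocartesian squares of ring homomorphisms, i.e. commutative squares
such that the induced map `R₁ ⊗_{S₁} S₂ → R₂` is an isomorphism. -/
@[ext]
structure AlgFl.Hom (h₁ h₂ : AlgFl.{u}) : Type u where
  g : h₁.S ⟶ h₂.S
  f : h₁.R ⟶ h₂.R
  isPushout : IsPushout h₁.h g f h₂.h

/-- The identity arrow. -/
def AlgFl.Hom.id (h : AlgFl.{u}) : AlgFl.Hom h h :=
  ⟨𝟙 _, 𝟙 _, IsPushout.of_vert_isIso ⟨by simp⟩⟩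

/-- Coordinate-wise composition. -/
def AlgFl.Hom.comp {h₁ h₂ h₃ : AlgFl.{u}} (a : AlgFl.Hom h₁ h₂) (b : AlgFl.Hom h₂ h₃) :
    AlgFl.Hom h₁ h₃ :=
  ⟨a.g ≫ b.g, a.f ≫ b.f, a.isPushout.paste_vert b.isPushout⟩

instance : Category AlgFl.{u} where
  Hom := AlgFl.Hom
  id := AlgFl.Hom.id
  comp := AlgFl.Hom.comp
  id_comp a := AlgFl.Hom.ext (Category.id_comp a.g) (Category.id_comp a.f)
  comp_id a := AlgFl.Hom.ext (Category.comp_id a.g) (Category.comp_id a.f)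
  assoc a b c := AlgFl.Hom.ext (Category.assoc a.g b.g c.g) (Category.assoc a.f b.f c.f)

/-- Objects of `mod^fl`: pairs `(h : S → R, N)` with `h` in `Alg^fl` and `N` an `S`-flat
finite `R`-module. -/
structure ModFl : Type (u + 1) where
  alg : AlgFl.{u}
  mod : ModuleCat.{u} alg.R
  prop : modFlat alg.h.hom mod

/-- Arrows of `mod^fl`: an arrow `(g, f)` of `Alg^fl` together with an `f`-linear map. -/
@[ext]
structure ModFl.Hom (N₁ N₂ : ModFl.{u}) : Type u where
  base : AlgFl.Hom N₁.alg N₂.alg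
  map : N₁.mod →+ N₂.mod
  map_smul : ∀ (x : N₁.alg.R) (m : N₁.mod), map (x • m) = base.f.hom x • map m

/-- The identity arrow. -/
def ModFl.Hom.id (N : ModFl.{u}) : ModFl.Hom N N :=
  ⟨AlgFl.Hom.id N.alg, AddMonoidHom.id _, fun _ _ => rfl⟩

/-- Composition of arrows. -/
def ModFl.Hom.comp {N₁ N₂ N₃ : ModFl.{u}} (φ : ModFl.Hom N₁ N₂) (ψ : ModFl.Hom N₂ N₃) :
    ModFl.Hom N₁ N₃ where
  base := AlgFl.Hom.comp φ.base ψ.base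
  map := ψ.map.comp φ.map
  map_smul x m := by
    change ψ.map (φ.map (x • m)) = ψ.base.f.hom (φ.base.f.hom x) • ψ.map (φ.map m)
    rw [φ.map_smul, ψ.map_smul]

instance : Category ModFl.{u} where
  Hom := ModFl.Hom
  id := ModFl.Hom.id
  comp := ModFl.Hom.comp
  id_comp _ := rfl
  comp_id _ := rfl
  assoc _ _ _ := rfl

/-- A linear map between modules in the fibre category `mod^fl_h`, as an arrow of
`mod^fl`. -/
def ModFl.ofHom {h : AlgFl.{u}} {M N : ModuleCat.{u} h.R} (hM : modFlat h.h.hom M)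
    (hN : modFlat h.h.hom N) (φ : M ⟶ N) :
    (ModFl.mk h M hM) ⟶ (ModFl.mk h N hN) :=
  show ModFl.Hom _ _ from
    { base := AlgFl.Hom.id h
      map := φ.hom.toAddMonoidHom
      map_smul := fun x m => φ.hom.map_smul x m }

/-- The full subcategory `P̂^fl(n)` of `mod^fl`. -/
def totP (n : ℕ) : ObjectProperty ModFl.{u} := fun N => catP n N.alg.h.hom N.mod

/-- The full subcategory `X(r)` of `mod^fl`. -/
def totX (r : ℕ) : ObjectProperty ModFl.{u} := fun N => catX r N.alg.h.hom N.mod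

/-- The full subcategory `Y(r, s)` of `mod^fl`. -/
def totY (r s : ℕ) : ObjectProperty ModFl.{u} := fun N => catY r s N.alg.h.hom N.mod

/-! ### Approximations (all subcategories are full) -/

section Approximation

universe v w

variable {C : Type w} [Category.{v} C]

/-- `π : M ⟶ N` is a right `X`-approximation of `N`. -/
def IsRightApprox (X : ObjectProperty C) {M N : C} (π : M ⟶ N) : Prop :=
  X M ∧ ∀ (M' : C) (φ : M' ⟶ N), X M' → ∃ ψ : M' ⟶ M, ψ ≫ π = φ

/-- `ι : N ⟶ L` is a left `X`-approximation of `N`. -/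
def IsLeftApprox (X : ObjectProperty C) {N L : C} (ι : N ⟶ L) : Prop :=
  X L ∧ ∀ (L' : C) (φ : N ⟶ L'), X L' → ∃ ψ : L ⟶ L', ι ≫ ψ = φ

/-- `π` is right minimal: every `η` with `π ∘ η = π` is an automorphism. -/
def IsRightMinimal {M N : C} (π : M ⟶ N) : Prop :=
  ∀ η : M ⟶ M, η ≫ π = π → IsIso η

/-- `ι` is left minimal: every `θ` with `θ ∘ ι = ι` is an automorphism. -/
def IsLeftMinimal {N L : C} (ι : N ⟶ L) : Prop :=
  ∀ θ : L ⟶ L, ι ≫ θ = ι → IsIso θ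

/-- `X` is a contravariantly finite subcategory of `Y`. -/
def ContravariantlyFinite (X Y : ObjectProperty C) : Prop :=
  X ≤ Y ∧ ∀ N, Y N → ∃ (M : C) (π : M ⟶ N), IsRightApprox X π

/-- `X` is a covariantly finite subcategory of `Y`. -/
def CovariantlyFinite (X Y : ObjectProperty C) : Prop :=
  X ≤ Y ∧ ∀ N, Y N → ∃ (L : C) (ι : N ⟶ L), IsLeftApprox X ι

end Approximation

/-! ### The two kinds of short exact sequences -/

/-- Sequences of kind (a): `0 → L → M → N → 0` short exact with `L` in `P̂^fl(s - 2)_h` and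
`M` in `X(r)_h`. -/
def IsSeqA {S R : Type u} [CommRing S] [CommRing R] (r s : ℕ) (h : S →+* R)
    (T : ShortComplex (ModuleCat.{u} R)) : Prop :=
  T.ShortExact ∧ catP (s - 2) h T.X₁ ∧ catX r h T.X₂

/-- Sequences of kind (b): `0 → N → L' → M' → 0` short exact with `L'` in `P̂^fl(s - 1)_h`
and `M'` in `X(r - 1)_h`. -/
def IsSeqB {S R : Type u} [CommRing S] [CommRing R] (r s : ℕ) (h : S →+* R)
    (T : ShortComplex (ModuleCat.{u} R)) : Prop :=
  T.ShortExact ∧ catP (s - 1) h T.X₂ ∧ catX (r - 1) h T.X₃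

/-- The base change `R₂ ⊗_{R₁} T` (which is `T ⊗_{S₁} S₂`) of a sequence of `R₁`-modules along
an arrow `(S₁ → R₁) ⟶ (S₂ → R₂)` of `Alg^fl`. -/
def baseChange {h₁ h₂ : AlgFl.{u}} (a : h₁ ⟶ h₂) (T : ShortComplex (ModuleCat.{u} h₁.R)) :
    ShortComplex (ModuleCat.{u} h₂.R) :=
  T.map (ModuleCat.extendScalars (AlgFl.Hom.f a).hom)

/-- `T` is a sequence of kind (a) for a module in `Y(r, s)_h`, and so is every base change
of `T`. -/
def IsStableSeqA (r s : ℕ) (h : AlgFl.{u}) (T : ShortComplex (ModuleCat.{u} h.R)) : Prop :=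
  (IsSeqA r s h.h.hom T ∧ catY r s h.h.hom T.X₃) ∧
    ∀ (h₂ : AlgFl.{u}) (a : h ⟶ h₂), IsSeqA r s h₂.h.hom (baseChange a T) ∧
      catY r s h₂.h.hom (baseChange a T).X₃

/-- `T` is a sequence of kind (b) for a module in `Y(r, s)_h`, and so is every base change
of `T`. -/
def IsStableSeqB (r s : ℕ) (h : AlgFl.{u}) (T : ShortComplex (ModuleCat.{u} h.R)) : Prop :=
  (IsSeqB r s h.h.hom T ∧ catY r s h.h.hom T.X₁) ∧
    ∀ (h₂ : AlgFl.{u}) (a : h ⟶ h₂), IsSeqB r s h₂.h.hom (baseChange a T) ∧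
      catY r s h₂.h.hom (baseChange a T).X₁

end

end FlatApprox

open FlatApprox

/-! The pivot is that for `n > 1` stable reflexivity of the fibres over the images of closed points
passes to every base change (`FibreSR.univSR`). Let P₂ → P₁ → P₀ → N be a start of a free
resolution. Then Ext¹(N, R) = 0 means that coker(P₀* → P₁*) → P₂* is injective. A local criterion
(`isPureInjective_of_residueField`) upgrades injectivity on those fibres to injectivity after
tensoring with any S-module. Hence N* is S-flat, dualizing commutes with base change, and Ext¹
vanishes after every base change (`dual_flat_of_fibreExtZero`). Applying this to N, to N* and to
their syzygies carries reflexivity and all the Ext conditions along.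

The sequences come from an induction on the syzygy index (`hasSeq_of_isSyzygy`). A stably reflexive
M embeds in a finite projective Q, the dual of a free cover of M*, with a cokernel that is stably
reflexive one level lower. If 0 → ΩN → L → M → 0 is of kind (b), then ΩN → P extends to L because
Ext¹(M, P) = 0, and gluing gives 0 → L → P ⊕ M → N → 0 of kind (a). Conversely, given 0 → L → M → N
→ 0 and M ⊂ Q, the sequence 0 → N → Q/L → Q/M → 0 is of kind (b). Flatness over S keeps all of this
exact under base change.

The obstruction to factoring a map through an approximation lies in Ext¹(X, L) with X stably
reflexive and L of small projective dimension. It vanishes by dimension shifting along a resolution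
of L (`ExtZero.of_pdLE`). An arrow over a nontrivial base is first made linear by base changing its
source, or the whole sequence.

Over a local ring, common free summands of rank one are split off until none is left. An
endomorphism compatible with the approximation then differs from the identity by a map that factors
through a finite projective module, and Nakayama's lemma makes it surjective, hence bijective.
Neither completeness nor a Krull–Schmidt property enters. -/

namespace FlatApprox

noncomputable section

/-! ### Universally injective maps and flatness -/

section Pure

variable {S : Type u} [CommRing S] {A B C : Type u} [AddCommGroup A] [AddCommGroup B]
  [AddCommGroup C] [Module S A] [Module S B] [Module S C]

/-- A linear map that stays injective after tensoring with any module. -/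
def IsPureInjective (f : A →ₗ[S] B) : Prop :=
  ∀ (T : Type u) [AddCommGroup T] [Module S T], Function.Injective (f.lTensor T)

lemma IsPureInjective.injective {f : A →ₗ[S] B}
    (hf : IsPureInjective f) : Function.Injective f := by
  have h := hf S
  intro x y hxy
  have : (1 : S) ⊗ₜ[S] x = 1 ⊗ₜ y := h (by simp [hxy])
  simpa using congrArg (TensorProduct.lid S A) this

/-- Chase for X ⊂ Y: an element of X ⊗ C that dies in Y ⊗ C lifts to X ⊗ B, and its image in Y ⊗ B
comes from Y ⊗ A. Purity against Y/X pushes that preimage down to X ⊗ A. -/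
lemma IsPureInjective.flat_of_exact [Module.Flat S B] {f : A →ₗ[S] B} (hf : IsPureInjective f)
    {g : B →ₗ[S] C} (hfg : Function.Exact f g) (hg : Function.Surjective g) :
    Module.Flat S C := by
  rw [Module.Flat.iff_rTensor_preserves_injective_linearMap]
  intro X Y _ _ _ _ i hi
  rw [injective_iff_map_eq_zero]
  intro z hz
  obtain ⟨w, rfl⟩ := LinearMap.lTensor_surjective X hg z
  have h1 : g.lTensor Y (i.rTensor B w) = 0 := by
    rw [← hz, ← LinearMap.comp_apply, ← LinearMap.comp_apply, LinearMap.lTensor_comp_rTensor,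
      LinearMap.rTensor_comp_lTensor]
  obtain ⟨a, ha⟩ := (lTensor_exact Y hfg hg _).1 h1
  have hpi : Function.Exact i (LinearMap.range i).mkQ := LinearMap.exact_map_mkQ_range i
  have h2 : (LinearMap.range i).mkQ.rTensor A a = 0 := by
    apply hf
    rw [map_zero, ← LinearMap.comp_apply, LinearMap.lTensor_comp_rTensor,
      ← LinearMap.rTensor_comp_lTensor, LinearMap.comp_apply, ha]
    exact (rTensor_exact B hpi (Submodule.mkQ_surjective _)).apply_apply_eq_zero w
  obtain ⟨a', rfl⟩ := (rTensor_exact A hpi (Submodule.mkQ_surjective _) _).1 h2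
  have h3 : w = f.lTensor X a' := by
    apply Module.Flat.rTensor_preserves_injective_linearMap i hi
    rw [← ha, ← LinearMap.comp_apply, ← LinearMap.comp_apply, LinearMap.lTensor_comp_rTensor,
      LinearMap.rTensor_comp_lTensor]
  rw [h3]
  exact (lTensor_exact X hfg hg).apply_apply_eq_zero a'

/-- This is Tor₁(T, C) = 0 without Tor: cover T by a free module F and chase, using that C is flat
against ker(F → T) ⊂ F and that F itself is flat. -/
lemma isPureInjective_of_flat [Module.Flat S C] {f : A →ₗ[S] B} (hf : Function.Injective f)
    {g : B →ₗ[S] C} (hfg : Function.Exact f g) (hg : Function.Surjective g) :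
    IsPureInjective f := by
  intro T _ _
  rw [injective_iff_map_eq_zero]
  intro z hz
  obtain ⟨F, _, _, _, q, hq⟩ : ∃ (F : Type u) (_ : AddCommGroup F) (_ : Module S F)
      (_ : Module.Flat S F) (q : F →ₗ[S] T), Function.Surjective q :=
    ⟨T →₀ S, inferInstance, inferInstance, inferInstance, Finsupp.linearCombination S id,
      Finsupp.linearCombination_id_surjective S T⟩
  have hX : Function.Exact (LinearMap.ker q).subtype q := LinearMap.exact_subtype_ker_map q
  obtain ⟨w, rfl⟩ := LinearMap.rTensor_surjective A hq z
  have h1 : q.rTensor B (f.lTensor F w) = 0 := by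
    rw [← hz, ← LinearMap.comp_apply, ← LinearMap.comp_apply, LinearMap.lTensor_comp_rTensor,
      LinearMap.rTensor_comp_lTensor]
  obtain ⟨b, hb⟩ := (rTensor_exact (f := (LinearMap.ker q).subtype) (g := q) B hX hq _).1 h1
  have h2 : g.lTensor (LinearMap.ker q) b = 0 := by
    apply Module.Flat.rTensor_preserves_injective_linearMap (LinearMap.ker q).subtype
        (Submodule.injective_subtype _)
    rw [map_zero, ← LinearMap.comp_apply, LinearMap.rTensor_comp_lTensor,
      ← LinearMap.lTensor_comp_rTensor, LinearMap.comp_apply, hb]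
    exact (lTensor_exact F hfg hg).apply_apply_eq_zero w
  obtain ⟨a, rfl⟩ := (lTensor_exact (LinearMap.ker q) hfg hg _).1 h2
  have h3 : w = (LinearMap.ker q).subtype.rTensor A a := by
    apply Module.Flat.lTensor_preserves_injective_linearMap f hf
    rw [← hb, ← LinearMap.comp_apply, ← LinearMap.comp_apply, LinearMap.lTensor_comp_rTensor,
      LinearMap.rTensor_comp_lTensor]
  rw [h3]
  exact (rTensor_exact (f := (LinearMap.ker q).subtype) (g := q) A hX hq).apply_apply_eq_zero a

lemma IsPureInjective.flat_left [Module.Flat S B] {f : A →ₗ[S] B} (hf : IsPureInjective f) :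
    Module.Flat S A := by
  rw [Module.Flat.iff_rTensor_preserves_injective_linearMap]
  intro X Y _ _ _ _ i hi
  have : Function.Injective (f.lTensor Y ∘ₗ i.rTensor A) := by
    rw [LinearMap.lTensor_comp_rTensor, ← LinearMap.rTensor_comp_lTensor]
    exact (Module.Flat.rTensor_preserves_injective_linearMap i hi).comp (hf X)
  exact Function.Injective.of_comp (f := f.lTensor Y) this

end Pure

/-! ### The local criterion at images of closed points -/

section LocalCriterion

variable {S R : Type u} [CommRing S] [CommRing R] [Algebra S R] {A B : Type u} [AddCommGroup A]
  [AddCommGroup B] [Module S A] [Module S B] [Module R A] [Module R B] [IsScalarTower S R A]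
  [IsScalarTower S R B]

/-- An element of a module killed by a prime ideal `p` that dies in the fibre at `p` is killed by
an element outside `p`. -/
lemma exists_smul_eq_zero_of_residueField_tmul_eq_zero (p : Ideal S) [p.IsPrime]
    (hA : ∀ s ∈ p, ∀ a : A, s • a = 0) (a : A)
    (ha : (1 : p.ResidueField) ⊗ₜ[S] a = 0) : ∃ s ∉ p, s • a = 0 := by
  -- As p kills A, tensoring A with the residue field is the same as localizing A at p.
  let L := Localization.AtPrime p
  let q : L →ₗ[S] p.ResidueField := (IsScalarTower.toAlgHom S L p.ResidueField).toLinearMap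
  have hq : Function.Surjective q := IsLocalRing.residue_surjective
  have hX : Function.Exact (LinearMap.ker q).subtype q := LinearMap.exact_subtype_ker_map q
  have h1 : q.rTensor A ((1 : L) ⊗ₜ[S] a) = 0 := by
    simp only [LinearMap.rTensor_tmul]
    rw [← ha]; congr 1
  obtain ⟨w, hw⟩ := (rTensor_exact (f := (LinearMap.ker q).subtype) (g := q) A hX hq _).1 h1
  have h2 : ∀ w, (LinearMap.ker q).subtype.rTensor A w = 0 := by
    intro w
    induction w with
    | zero => simp
    | add x y hx hy => rw [map_add, hx, hy, add_zero]
    | tmul x b =>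
      obtain ⟨x, hx⟩ := x
      obtain ⟨c, s, rfl⟩ := IsLocalization.exists_mk'_eq p.primeCompl x
      have hc : c ∈ p := by
        have : IsLocalization.mk' L c s ∈ IsLocalRing.maximalIdeal L :=
          (IsLocalRing.residue_eq_zero_iff _).1 hx
        exact (IsLocalization.AtPrime.mk'_mem_maximal_iff L p c s).1 this
      have : IsLocalization.mk' L c s = c • IsLocalization.mk' L 1 s := by
        rw [IsLocalization.smul_mk', mul_one]
      simp only [LinearMap.rTensor_tmul, Submodule.subtype_apply]
      rw [this, TensorProduct.smul_tmul, hA c hc, tmul_zero]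
  rw [h2] at hw
  have : IsLocalizedModule p.primeCompl (TensorProduct.mk S L A 1) :=
    (isLocalizedModule_iff_isBaseChange p.primeCompl L _).2 (TensorProduct.isBaseChange S A L)
  obtain ⟨s, hs⟩ := (IsLocalizedModule.eq_zero_iff p.primeCompl
      (TensorProduct.mk S L A 1)).1 hw.symm
  exact ⟨s, s.2, hs⟩

/-- Local criterion of flatness, in the form of an injectivity statement. -/
theorem isPureInjective_of_residueField [IsNoetherianRing R] [Module.Finite R A]
    [Module.Flat S B] (f : A →ₗ[R] B)
    (hf : ∀ m : Ideal R, m.IsMaximal → ∀ (p : Ideal S) [p.IsPrime], p = m.comap (algebraMap S R) →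
      Function.Injective ((f.restrictScalars S).lTensor p.ResidueField)) :
    IsPureInjective (f.restrictScalars S) := by
  let fS := f.restrictScalars S
  -- tensoring on the right keeps the `R`-structure
  let fT (T : Type u) [AddCommGroup T] [Module S T] : A ⊗[S] T →ₗ[R] B ⊗[S] T :=
    AlgebraTensorModule.rTensor S T f
  have fT_apply (T : Type u) [AddCommGroup T] [Module S T] (x) : fT T x = fS.rTensor T x := rfl
  have swap (T : Type u) [AddCommGroup T] [Module S T] (h : ∀ x, fT T x = 0 → x = 0) :
      Function.Injective (fS.lTensor T) := by
    rw [injective_iff_map_eq_zero]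
    intro z hz
    have := h (TensorProduct.comm S T A z) (by
      rw [fT_apply, ← LinearMap.comm_comp_lTensor_comp_comm_eq]
      simp [hz])
    simpa using this
  -- modules killed by the prime
  have key0 : ∀ m : Ideal R, m.IsMaximal → ∀ (T : Type u) [AddCommGroup T] [Module S T],
      (∀ s ∈ m.comap (algebraMap S R), ∀ t : T, s • t = 0) →
      ∀ x, fT T x = 0 → ∃ r ∉ m, r • x = 0 := by
    intro m hm T _ _ hT x hx
    let p := m.comap (algebraMap S R)
    have := hm.isPrime
    let K := p.ResidueField
    have h0 : Function.Injective (f.restrictScalars S |>.baseChange K) := hf m hm p rfl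
    -- Over the field K the injection splits, so it stays injective after tensoring with T. Thus x
    -- dies in the fibre at p, which gives a multiplier outside p and therefore outside m.
    obtain ⟨g, hg⟩ := (fS.baseChange K).exists_leftInverse_of_injective (LinearMap.ker_eq_bot.2 h0)
    have h1 : (g.restrictScalars S).rTensor T ∘ₗ
        ((fS.baseChange K).restrictScalars S).rTensor T = LinearMap.id := by
      rw [← LinearMap.rTensor_comp, ← LinearMap.restrictScalars_comp, hg]
      exact LinearMap.rTensor_id _ _
    have h2 : ∀ y, ((fS.baseChange K).restrictScalars S).rTensor T
        ((TensorProduct.assoc S K A T).symm (1 ⊗ₜ y)) =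
        (TensorProduct.assoc S K B T).symm (1 ⊗ₜ fT T y) := by
      intro y
      induction y with
      | zero => simp
      | add a b ha hb => simp only [tmul_add, map_add, ha, hb]
      | tmul a t => rfl
    have h3 : (1 : K) ⊗ₜ[S] x = 0 := by
      have := LinearMap.congr_fun h1 ((TensorProduct.assoc S K A T).symm (1 ⊗ₜ x))
      rw [LinearMap.comp_apply, h2, hx] at this
      simpa using this.symm
    obtain ⟨s, hs, hsx⟩ := exists_smul_eq_zero_of_residueField_tmul_eq_zero p (by
      intro s hs a
      induction a with
      | zero => simp
      | add a b ha hb => rw [smul_add, ha, hb, add_zero]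
      | tmul a t => rw [smul_tmul', smul_tmul, hT s hs, tmul_zero]) x h3
    exact ⟨algebraMap S R s, hs, by rw [algebraMap_smul]; exact hsx⟩
  -- Dévissage along pT ⊂ T. Flatness of B keeps B ⊗ pT → B ⊗ T injective, so a kernel element that
  -- vanishes in A ⊗ T/pT, up to a multiplier outside m, comes from the kernel for pT.
  have key1 : ∀ m : Ideal R, m.IsMaximal → ∀ (j : ℕ) (T : Type u) [AddCommGroup T] [Module S T],
      (∀ s ∈ (m.comap (algebraMap S R)) ^ j, ∀ t : T, s • t = 0) →
      ∀ x, fT T x = 0 → ∃ r ∉ m, r • x = 0 := by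
    intro m hm j
    induction j with
    | zero =>
      intro T _ _ hT x hx
      have : Subsingleton T := ⟨fun a b => by
        simpa [sub_eq_zero] using hT 1 (by simp) (a - b)⟩
      exact ⟨1, m.ne_top_iff_one.1 hm.ne_top, Subsingleton.elim _ _⟩
    | succ j ih =>
      intro T _ _ hT x hx
      set p := m.comap (algebraMap S R)
      let T' : Submodule S T := p • ⊤
      have hnat : ∀ {T₁ T₂ : Type u} [AddCommGroup T₁] [Module S T₁] [AddCommGroup T₂]
          [Module S T₂] (g : T₁ →ₗ[S] T₂) (y), fT T₂ (g.lTensor A y) = g.lTensor B (fT T₁ y) := by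
        intro T₁ T₂ _ _ _ _ g y
        rw [fT_apply, fT_apply, ← LinearMap.comp_apply, ← LinearMap.comp_apply,
          LinearMap.lTensor_comp_rTensor, LinearMap.rTensor_comp_lTensor]
      obtain ⟨r, hr, h1⟩ := key0 m hm (T ⧸ T') (by
        intro s hs t
        obtain ⟨t, rfl⟩ := T'.mkQ_surjective t
        rw [← map_smul, Submodule.mkQ_apply, Submodule.Quotient.mk_eq_zero]
        exact Submodule.smul_mem_smul hs trivial) (T'.mkQ.lTensor A x) (by rw [hnat, hx, map_zero])
      have h2 : T'.mkQ.lTensor A (r • x) = 0 := by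
        rw [← h1]; exact (AlgebraTensorModule.lTensor R A T'.mkQ).map_smul r x
      have hex : Function.Exact T'.subtype T'.mkQ := LinearMap.exact_subtype_mkQ T'
      obtain ⟨y, hy⟩ := (lTensor_exact A hex T'.mkQ_surjective _).1 h2
      have h3 : fT T' y = 0 := by
        apply Module.Flat.lTensor_preserves_injective_linearMap T'.subtype T'.injective_subtype
        rw [map_zero, ← hnat, hy, map_smul, hx, smul_zero]
      obtain ⟨r', hr', h4⟩ := ih T' (by
        rintro s hs ⟨t, ht⟩
        ext
        simp only [SetLike.mk_smul_mk, ZeroMemClass.coe_zero]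
        refine Submodule.smul_induction_on ht (fun c hc t _ => ?_) (fun a b ha hb => ?_)
        · rw [smul_smul]
          exact hT _ (by rw [pow_succ]; exact Ideal.mul_mem_mul hs hc) t
        · rw [smul_add, ha, hb, add_zero]) y h3
      refine ⟨r' * r, fun h => (hm.isPrime.mem_or_mem h).elim hr' hr, ?_⟩
      rw [mul_smul, ← hy]
      have := (AlgebraTensorModule.lTensor R A T'.subtype).map_smul r' y
      rw [h4, map_zero] at this
      exact this.symm
  -- For T finite over S, a nonzero kernel element x has its annihilator in some maximal ideal m.
  -- The quotients T/pʲT show that x lies in every mʲ(A ⊗ T). Krull's intersection theorem then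
  -- yields an annihilator in 1 + m, a contradiction.
  have key2 : ∀ (T : Type u) [AddCommGroup T] [Module S T] [Module.Finite S T],
      Function.Injective (fS.lTensor T) := by
    intro T _ _ _
    apply swap
    intro x hx
    by_contra hne
    let J := LinearMap.ker (LinearMap.toSpanSingleton R _ x)
    have hJ : J ≠ ⊤ := fun h => hne (by
      have : (1 : R) ∈ J := h ▸ trivial
      simpa [J] using this)
    obtain ⟨m, hm, hJm⟩ := Ideal.exists_le_maximal J hJ
    set p := m.comap (algebraMap S R) with hp
    have h1 : x ∈ (⨅ i : ℕ, m ^ i • ⊤ : Submodule R (A ⊗[S] T)) := by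
      rw [Submodule.mem_iInf]
      intro j
      let T' : Submodule S T := p ^ j • ⊤
      obtain ⟨r, hr, h2⟩ := key1 m hm j (T ⧸ T') (by
        intro s hs t
        obtain ⟨t, rfl⟩ := T'.mkQ_surjective t
        rw [← map_smul, Submodule.mkQ_apply, Submodule.Quotient.mk_eq_zero]
        exact Submodule.smul_mem_smul hs trivial) (T'.mkQ.lTensor A x) (by
          rw [fT_apply, ← LinearMap.comp_apply, LinearMap.rTensor_comp_lTensor,
            ← LinearMap.lTensor_comp_rTensor, LinearMap.comp_apply, ← fT_apply, hx, map_zero])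
      have h3 : T'.mkQ.lTensor A (r • x) = 0 := by
        rw [← h2]; exact (AlgebraTensorModule.lTensor R A T'.mkQ).map_smul r x
      have hex : Function.Exact T'.subtype T'.mkQ := LinearMap.exact_subtype_mkQ T'
      obtain ⟨y, hy⟩ := (lTensor_exact A hex T'.mkQ_surjective _).1 h3
      have h4 : ∀ y, T'.subtype.lTensor A y ∈ (m ^ j • ⊤ : Submodule R (A ⊗[S] T)) := by
        intro y
        induction y with
        | zero => simp
        | add a b ha hb => rw [map_add]; exact add_mem ha hb
        | tmul a t =>
          obtain ⟨t, ht⟩ := t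
          rw [LinearMap.lTensor_tmul, Submodule.subtype_apply]
          simp only
          refine Submodule.smul_induction_on ht (fun c hc t _ => ?_) (fun a b ha hb => ?_)
          · rw [← smul_tmul, ← algebraMap_smul R c a, ← smul_tmul']
            refine Submodule.smul_mem_smul ?_ trivial
            have : p ^ j ≤ (m ^ j).comap (algebraMap S R) := Ideal.le_comap_pow _ _
            exact this hc
          · rw [tmul_add]; exact add_mem ha hb
      have h5 := h4 y
      rw [hy] at h5
      -- The multiplier r is invertible modulo mʲ: from vr + i = 1 with i in m one gets 1 = iʲ +
      -- wvr.
      obtain ⟨v, i, hi, hvi⟩ := hm.exists_inv hr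
      obtain ⟨w, hw⟩ := one_sub_dvd_one_sub_pow i j
      have h6 : x = i ^ j • x + (w * v) • r • x := by
        rw [smul_smul, ← add_smul, show i ^ j + w * v * r = 1 by
          linear_combination w * hvi - hw, one_smul]
      rw [h6]
      exact add_mem (Submodule.smul_mem_smul (Ideal.pow_mem_pow hi j) trivial)
        (Submodule.smul_mem _ _ h5)
    have : Module.Finite R (A ⊗[S] T) :=
      Module.Finite.equiv (AlgebraTensorModule.cancelBaseChange S R R A T)
    obtain ⟨⟨t, ht⟩, htx⟩ := (m.mem_iInf_smul_pow_eq_bot_iff x).1 h1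
    have : 1 - t ∈ J := by
      simp only [J, LinearMap.mem_ker, LinearMap.toSpanSingleton_apply, sub_smul, one_smul]
      rw [htx, sub_self]
    exact hm.ne_top (m.eq_top_iff_one.2 (by simpa using m.add_mem (hJm this) ht))
  intro T _ _
  rw [injective_iff_map_eq_zero]
  intro z hz
  obtain ⟨T', _, hT'⟩ := TensorProduct.exists_finite_submodule_left_of_setFinite {z} (by simp)
  obtain ⟨y, rfl⟩ := hT' rfl
  have : y = 0 := by
    apply key2 T'
    apply Module.Flat.rTensor_preserves_injective_linearMap T'.subtype T'.injective_subtype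
    rw [map_zero, map_zero, ← hz, ← LinearMap.comp_apply, ← LinearMap.comp_apply,
      LinearMap.lTensor_comp_rTensor, LinearMap.rTensor_comp_lTensor]
  rw [this, map_zero]

end LocalCriterion

/-! ### Short exact sequences, vanishing of Ext and projective dimension -/

section ShortExactSequences

/-- `0 → K → P → N → 0` is short exact. -/
structure IsSES {A : Type*} [CommRing A] {K P N : Type*} [AddCommMonoid K] [AddCommMonoid P]
    [AddCommMonoid N] [Module A K] [Module A P] [Module A N] (i : K →ₗ[A] P)
        (p : P →ₗ[A] N) : Prop where
  inj : Function.Injective i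
  exact : Function.Exact i p
  surj : Function.Surjective p

variable {A : Type*} [CommRing A] {K P N : Type*} [AddCommGroup K] [AddCommGroup P]
  [AddCommGroup N] [Module A K] [Module A P] [Module A N]

lemma IsSES.of_surjective {p : P →ₗ[A] N} (hp : Function.Surjective p) :
    IsSES (LinearMap.ker p).subtype p :=
  ⟨Submodule.injective_subtype _, LinearMap.exact_subtype_ker_map p, hp⟩

lemma IsSES.of_injective {i : K →ₗ[A] P} (hi : Function.Injective i) :
    IsSES i (LinearMap.range i).mkQ :=
  ⟨hi, LinearMap.exact_map_mkQ_range i, Submodule.mkQ_surjective _⟩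

lemma IsSES.of_submodule (B : Submodule A P) : IsSES B.subtype B.mkQ :=
  ⟨B.injective_subtype, LinearMap.exact_subtype_mkQ B, B.mkQ_surjective⟩

end ShortExactSequences

section Ext

variable {A : Type u} [CommRing A] {K P N X : Type u} [AddCommGroup K] [AddCommGroup P]
  [AddCommGroup N] [AddCommGroup X] [Module A K] [Module A P] [Module A N] [Module A X]

variable (A M X) in
/-- The vanishing of `Ext^i_A(M, X)`. -/
def ExtZero (M X : Type u) [AddCommGroup M] [AddCommGroup X] [Module A M] [Module A X]
    (i : ℕ) : Prop :=
  Subsingleton (Abelian.Ext (ModuleCat.of A M) (ModuleCat.of A X) i)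

variable (A) in
/-- `L` has projective dimension at most `n`. -/
def PdLE (L : Type u) [AddCommGroup L] [Module A L] (n : ℕ) : Prop :=
  HasProjectiveDimensionLE (ModuleCat.of A L) n

lemma ExtZero.eq_zero {M : Type u} [AddCommGroup M] [Module A M] {i : ℕ} (h : ExtZero A M X i)
    (x : Abelian.Ext (ModuleCat.of A M) (ModuleCat.of A X) i) : x = 0 :=
  h.elim _ _

lemma extZero_of_eq_zero {M : Type u} [AddCommGroup M] [Module A M] {i : ℕ}
    (h : ∀ x : Abelian.Ext (ModuleCat.of A M) (ModuleCat.of A X) i, x = 0) : ExtZero A M X i :=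
  ⟨fun x y => by rw [h x, h y]⟩

variable {i : K →ₗ[A] P} {p : P →ₗ[A] N}

lemma IsSES.comp_eq_zero (h : IsSES i p) : ModuleCat.ofHom i ≫ ModuleCat.ofHom p = 0 := by
  ext x; exact h.exact.apply_apply_eq_zero x

/-- A short exact sequence of modules as a short complex. -/
abbrev IsSES.toShortComplex (h : IsSES i p) : ShortComplex (ModuleCat.{u} A) :=
  ShortComplex.mk (ModuleCat.ofHom i) (ModuleCat.ofHom p) h.comp_eq_zero

lemma shortExact_mk_iff {X Y Z : ModuleCat.{u} A} (f : X ⟶ Y) (g : Y ⟶ Z) (w : f ≫ g = 0) :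
    (ShortComplex.mk f g w).ShortExact ↔ IsSES f.hom g.hom := by
  constructor
  · intro h
    exact ⟨h.moduleCat_injective_f,
      (ShortComplex.ShortExact.moduleCat_exact_iff_function_exact _).1 h.exact,
      h.moduleCat_surjective_g⟩
  · intro h
    exact { exact := (ShortComplex.ShortExact.moduleCat_exact_iff_function_exact _).2 h.exact
            mono_f := (ModuleCat.mono_iff_injective _).2 h.inj
            epi_g := (ModuleCat.epi_iff_surjective _).2 h.surj }

lemma IsSES.shortExact (h : IsSES i p) : h.toShortComplex.ShortExact :=
  (shortExact_mk_iff _ _ _).2 h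

/-! ### First variable -/

lemma ExtZero.X₂ (h : IsSES i p) {n : ℕ} (h₁ : ExtZero A K X n) (h₃ : ExtZero A N X n) :
    ExtZero A P X n := by
  refine extZero_of_eq_zero fun x => ?_
  obtain ⟨y, rfl⟩ := Abelian.Ext.contravariant_sequence_exact₂ h.shortExact _ x (h₁.eq_zero _)
  rw [show y = 0 from h₃.eq_zero _, Abelian.Ext.comp_zero]

lemma ExtZero.X₃ (h : IsSES i p) {n : ℕ} (h₁ : ExtZero A K X n) (h₂ : ExtZero A P X (n + 1)) :
    ExtZero A N X (n + 1) := by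
  refine extZero_of_eq_zero fun x => ?_
  obtain ⟨y, rfl⟩ := Abelian.Ext.contravariant_sequence_exact₃ h.shortExact _ x (h₂.eq_zero _)
    (add_comm 1 n)
  rw [show y = 0 from h₁.eq_zero _, Abelian.Ext.comp_zero]

lemma ExtZero.X₁ (h : IsSES i p) {n : ℕ} (h₂ : ExtZero A P X n) (h₃ : ExtZero A N X (n + 1)) :
    ExtZero A K X n := by
  refine extZero_of_eq_zero fun x => ?_
  obtain ⟨y, rfl⟩ := Abelian.Ext.contravariant_sequence_exact₁ h.shortExact _ x
    (add_comm 1 n) (h₃.eq_zero _)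
  rw [show y = 0 from h₂.eq_zero _, Abelian.Ext.comp_zero]

lemma extZero_of_projective [Module.Projective A P] (n : ℕ) : ExtZero A P X (n + 1) :=
  extZero_of_eq_zero fun x =>
    have := (IsProjective.iff_projective (R := A) P).1 inferInstance
    Abelian.Ext.eq_zero_of_projective x

lemma ExtZero.exists_extend (h : IsSES i p) (hN : ExtZero A N X 1) (φ : K →ₗ[A] X) :
    ∃ ψ : P →ₗ[A] X, ψ ∘ₗ i = φ := by
  obtain ⟨y, hy⟩ := Abelian.Ext.contravariant_sequence_exact₁ h.shortExact (ModuleCat.of A X)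
    (Abelian.Ext.mk₀ (ModuleCat.ofHom φ)) (add_comm 1 0) (hN.eq_zero _)
  obtain ⟨ψ, rfl⟩ := (Abelian.Ext.mk₀_bijective _ _).2 y
  rw [Abelian.Ext.mk₀_comp_mk₀] at hy
  have := (Abelian.Ext.mk₀_bijective _ _).1 hy
  refine ⟨ψ.hom, ?_⟩
  have h' := congrArg ModuleCat.Hom.hom this
  exact h'

lemma extZero_one_of_extend [Module.Projective A P] (h : IsSES i p)
    (hX : ∀ φ : K →ₗ[A] X, ∃ ψ : P →ₗ[A] X, ψ ∘ₗ i = φ) : ExtZero A N X 1 := by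
  refine extZero_of_eq_zero fun x => ?_
  obtain ⟨y, rfl⟩ := Abelian.Ext.contravariant_sequence_exact₃ h.shortExact _ x
    ((extZero_of_projective (P := P) 0).eq_zero _) (add_comm 1 0)
  obtain ⟨φ, rfl⟩ := (Abelian.Ext.mk₀_bijective _ _).2 y
  obtain ⟨ψ, hψ⟩ := hX φ.hom
  have : φ = h.toShortComplex.f ≫ ModuleCat.ofHom ψ := by
    ext x; exact (LinearMap.congr_fun hψ x).symm
  rw [this, ← Abelian.Ext.mk₀_comp_mk₀, ← Abelian.Ext.comp_assoc (h₁₂ := add_zero 1) (h := by lia),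
    h.shortExact.extClass_comp, Abelian.Ext.zero_comp]

lemma extZero_succ_iff [Module.Projective A P] (h : IsSES i p) (n : ℕ) :
    ExtZero A N X (n + 2) ↔ ExtZero A K X (n + 1) :=
  ⟨fun h₃ => .X₁ h (extZero_of_projective n) h₃, fun h₁ => .X₃ h h₁ (extZero_of_projective _)⟩

lemma ExtZero.of_retract {n : ℕ} (h : ExtZero A P X n) (f : N →ₗ[A] P) (g : P →ₗ[A] N)
    (hgf : g ∘ₗ f = LinearMap.id) : ExtZero A N X n := by
  refine extZero_of_eq_zero fun x => ?_
  have : ModuleCat.ofHom f ≫ ModuleCat.ofHom g = 𝟙 (ModuleCat.of A N) := by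
    ext y; exact LinearMap.congr_fun hgf y
  rw [← x.mk₀_id_comp, ← this, ← Abelian.Ext.mk₀_comp_mk₀,
    Abelian.Ext.comp_assoc_of_second_deg_zero,
    h.eq_zero (Abelian.Ext.comp _ x (zero_add n)), Abelian.Ext.comp_zero]

lemma ExtZero.congr {n : ℕ} (h : ExtZero A P X n) (e : P ≃ₗ[A] N) : ExtZero A N X n :=
  h.of_retract e.symm.toLinearMap e.toLinearMap (by ext; simp)

/-! ### Second variable -/

lemma ExtZero.of_retract_right {n : ℕ} (h : ExtZero A X P n) (f : N →ₗ[A] P) (g : P →ₗ[A] N)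
    (hgf : g ∘ₗ f = LinearMap.id) : ExtZero A X N n := by
  refine extZero_of_eq_zero fun x => ?_
  have : ModuleCat.ofHom f ≫ ModuleCat.ofHom g = 𝟙 (ModuleCat.of A N) := by
    ext y; exact LinearMap.congr_fun hgf y
  rw [← x.comp_mk₀_id, ← this, ← Abelian.Ext.mk₀_comp_mk₀,
    ← Abelian.Ext.comp_assoc_of_second_deg_zero,
    h.eq_zero (x.comp _ (add_zero n)), Abelian.Ext.zero_comp]

lemma ExtZero.X₃_right (h : IsSES i p) {n : ℕ} (h₂ : ExtZero A X P n)
    (h₁ : ExtZero A X K (n + 1)) : ExtZero A X N n := by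
  refine extZero_of_eq_zero fun x => ?_
  obtain ⟨y, rfl⟩ := Abelian.Ext.covariant_sequence_exact₃ _ h.shortExact x rfl (h₁.eq_zero _)
  rw [show y = 0 from h₂.eq_zero _, Abelian.Ext.zero_comp]

lemma ExtZero.right_of_projective {M : Type u} [AddCommGroup M] [Module A M] {n : ℕ}
    (h : ExtZero A M A n) [Module.Finite A P] [Module.Projective A P] : ExtZero A M P n := by
  obtain ⟨k, f, g, -, -, hfg⟩ := Module.Finite.exists_comp_eq_id_of_projective A P
  have hk : ∀ k : ℕ, ExtZero A M (Fin k → A) n := by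
    intro k
    refine extZero_of_eq_zero fun x => ?_
    have : 𝟙 (ModuleCat.of A (Fin k → A)) = ∑ j, ModuleCat.ofHom (LinearMap.proj j) ≫
        ModuleCat.ofHom (LinearMap.single A (fun _ : Fin k => A) j) := by
      ext y l
      simp [Pi.single_apply]
    rw [← x.comp_mk₀_id, this, Abelian.Ext.mk₀_sum, Abelian.Ext.comp_sum]
    refine Finset.sum_eq_zero fun j _ => ?_
    rw [← Abelian.Ext.mk₀_comp_mk₀, ← Abelian.Ext.comp_assoc_of_second_deg_zero,
      h.eq_zero (x.comp _ (add_zero n)), Abelian.Ext.zero_comp]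
  exact (hk k).of_retract_right g f hfg

/-! ### Projective dimension -/

lemma PdLE.of_le {m n : ℕ} (h : PdLE A N m) (hmn : m ≤ n) : PdLE A N n :=
  have : HasProjectiveDimensionLT (ModuleCat.of A N) (m + 1) := h
  hasProjectiveDimensionLT_of_ge _ (m + 1) (n + 1) (by lia)

lemma pdLE_zero_iff : PdLE A N 0 ↔ Module.Projective A N := by
  rw [PdLE, ← projective_iff_hasProjectiveDimensionLE_zero, ← IsProjective.iff_projective]

lemma PdLE.X₁ (h : IsSES i p) {n : ℕ} (h₂ : PdLE A P n) (h₃ : PdLE A N (n + 1)) : PdLE A K n :=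
  h.shortExact.hasProjectiveDimensionLT_X₁ (n + 1) h₂ h₃

lemma PdLE.X₂ (h : IsSES i p) {n : ℕ} (h₁ : PdLE A K n) (h₃ : PdLE A N n) : PdLE A P n :=
  h.shortExact.hasProjectiveDimensionLT_X₂ (n + 1) h₁ h₃

lemma PdLE.X₃ (h : IsSES i p) {n : ℕ} (h₁ : PdLE A K n) (h₂ : PdLE A P (n + 1)) :
    PdLE A N (n + 1) :=
  h.shortExact.hasProjectiveDimensionLT_X₃ (n + 1) h₁ h₂

lemma PdLE.of_retract {n : ℕ} (h : PdLE A P n) (f : N →ₗ[A] P) (g : P →ₗ[A] N)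
    (hgf : g ∘ₗ f = LinearMap.id) : PdLE A N n :=
  have : HasProjectiveDimensionLT (ModuleCat.of A P) (n + 1) := h
  Retract.hasProjectiveDimensionLT (Y := ModuleCat.of A P) ⟨ModuleCat.ofHom f, ModuleCat.ofHom g, by
    ext y; exact LinearMap.congr_fun hgf y⟩ (n + 1)

/-- Over a noetherian ring, `Ext^i(M, L) = 0` if `Ext^j(M, A)` vanishes for `i ≤ j ≤ i + d` and
the finite module `L` has projective dimension at most `d`. -/
lemma ExtZero.of_pdLE [IsNoetherianRing A] {M : Type u} [AddCommGroup M] [Module A M] {n : ℕ}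
    (h : ∀ j, 0 < j → j < n → ExtZero A M A j) (d : ℕ) :
    ∀ (L : Type u) [AddCommGroup L] [Module A L] [Module.Finite A L], PdLE A L d →
      ∀ j, 0 < j → j + d < n → ExtZero A M L j := by
  induction d with
  | zero =>
    intro L _ _ _ hL j hj hjn
    have := pdLE_zero_iff.1 hL
    exact (h j hj (by lia)).right_of_projective
  | succ d ih =>
    intro L _ _ _ hL j hj hjn
    -- Dimension shift in L: each syzygy step lowers the projective dimension by one and raises the
    -- Ext degree by one, so `j + d` is constant.
    obtain ⟨k, q, hq⟩ := Module.Finite.exists_fin' A L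
    have hs := IsSES.of_surjective hq
    have hfree : PdLE A (Fin k → A) d := (pdLE_zero_iff.2 inferInstance).of_le (Nat.zero_le d)
    exact .X₃_right hs (h j hj (by lia)).right_of_projective
      (ih _ (.X₁ hs hfree hL) (j + 1) (by lia) (by lia))

end Ext

/-! ### Duals, free presentations and base change -/

section DualBaseChange

variable {R : Type*} [CommRing R] (R' : Type*) [CommRing R'] [Algebra R R']
  {M N : Type*} [AddCommGroup M] [AddCommGroup N] [Module R M] [Module R N]

variable (R M) in
/-- The canonical map `R' ⊗ M^* → (R' ⊗ M)^*`. -/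
def dualComparison : R' ⊗[R] Module.Dual R M →ₗ[R'] Module.Dual R' (R' ⊗[R] M) :=
  LinearMap.liftBaseChange R' (Module.Dual.baseChange R')

@[simp]
lemma dualComparison_tmul (a b : R') (f : Module.Dual R M) (x : M) :
    dualComparison R R' M (a ⊗ₜ f) (b ⊗ₜ x) = a * (f x • b) := by
  simp [dualComparison]

lemma dualComparison_naturality (f : M →ₗ[R] N) (x : R' ⊗[R] Module.Dual R N) :
    dualComparison R R' M (f.dualMap.baseChange R' x) =
      (f.baseChange R').dualMap (dualComparison R R' N x) := by
  have : dualComparison R R' M ∘ₗ f.dualMap.baseChange R' =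
      (f.baseChange R').dualMap ∘ₗ dualComparison R R' N := by
    ext g y; simp
  exact LinearMap.congr_fun this x

lemma dualComparison_bijective_of_free [Module.Free R M] [Module.Finite R M] :
    Function.Bijective (dualComparison R R' M) := by
  have : dualComparison R R' M =
      ((TensorProduct.isBaseChange R M R').toDualBaseChange).toLinearMap := by
    ext g y
    have := (TensorProduct.isBaseChange R M R').toDualBaseChange_tmul 1 g y
    simp only [mk_apply] at this
    simp [this, Algebra.algebraMap_eq_smul_one]
  rw [this]
  exact LinearEquiv.bijective _

end DualBaseChange

section Resolution

variable {A : Type u} [CommRing A] {N P₀ P₁ P₂ K₁ K₂ : Type u} [AddCommGroup N] [AddCommGroup P₀]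
  [AddCommGroup P₁] [AddCommGroup P₂] [AddCommGroup K₁] [AddCommGroup K₂]
  [Module A N] [Module A P₀] [Module A P₁] [Module A P₂] [Module A K₁] [Module A K₂]
  {i₁ : K₁ →ₗ[A] P₀} {p₀ : P₀ →ₗ[A] N} {i₂ : K₂ →ₗ[A] P₁} {p₁ : P₁ →ₗ[A] K₁} {p₂ : P₂ →ₗ[A] K₂}

lemma exists_comp_eq_of_ses (h : IsSES i₂ p₁) {X : Type*} [AddCommGroup X] [Module A X]
    (φ : P₁ →ₗ[A] X) (hφ : φ ∘ₗ i₂ = 0) : ∃ φ' : K₁ →ₗ[A] X, φ' ∘ₗ p₁ = φ := by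
  refine ⟨(LinearMap.ker p₁).liftQ φ ?_ ∘ₗ (p₁.quotKerEquivOfSurjective h.surj).symm, ?_⟩
  · intro x hx
    obtain ⟨y, rfl⟩ := (h.exact x).1 hx
    exact LinearMap.congr_fun hφ y
  · ext x
    have : (p₁.quotKerEquivOfSurjective h.surj).symm (p₁ x) = Submodule.Quotient.mk x := by
      rw [LinearEquiv.symm_apply_eq]; rfl
    simp [this]

/-- Functionals on P₁ killed on P₂ are the functionals on the first syzygy, and those restricted
from P₀ are the extendable ones; Ext¹ is the quotient. This form makes sense after any base change.
-/
lemma extZero_one_iff_exact_dual [Module.Projective A P₀] (h₀ : IsSES i₁ p₀) (h₁ : IsSES i₂ p₁)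
    (h₂ : Function.Surjective p₂) :
    ExtZero A N A 1 ↔ Function.Exact (i₁ ∘ₗ p₁).dualMap (i₂ ∘ₗ p₂).dualMap := by
  constructor
  · intro h φ
    constructor
    · intro hφ
      obtain ⟨φ', hφ'⟩ := exists_comp_eq_of_ses h₁ φ (by
        ext x
        obtain ⟨y, rfl⟩ := h₂ x
        exact LinearMap.congr_fun hφ y)
      obtain ⟨ψ, hψ⟩ := h.exists_extend h₀ φ'
      refine ⟨ψ, ?_⟩
      rw [← hφ', ← hψ]; rfl
    · rintro ⟨ψ, rfl⟩
      ext x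
      have := h₁.exact.apply_apply_eq_zero (p₂ x)
      simp [this]
  · intro h
    refine extZero_one_of_extend h₀ fun φ => ?_
    obtain ⟨ψ, hψ⟩ := (h (φ ∘ₗ p₁)).1 (by
      ext x
      have := h₁.exact.apply_apply_eq_zero (p₂ x)
      simp [this])
    refine ⟨ψ, ?_⟩
    ext x
    obtain ⟨y, rfl⟩ := h₁.surj x
    exact LinearMap.congr_fun hψ y

end Resolution

section BaseChange

variable {S R : Type u} [CommRing S] [CommRing R] [Algebra S R]
  {S' R' : Type u} [CommRing S'] [CommRing R'] [Algebra S S'] [Algebra R R'] [Algebra S' R']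
  [Algebra S R'] [IsScalarTower S R R'] [IsScalarTower S S' R'] 

variable {A B C : Type u} [AddCommGroup A] [AddCommGroup B] [AddCommGroup C]
  [Module R A] [Module R B] [Module R C] [Module S A] [Module S B] [Module S C]
  [IsScalarTower S R A] [IsScalarTower S R B] [IsScalarTower S R C]

variable (S S' R') in
lemma injective_baseChange_iff [Algebra.IsPushout S S' R R'] (f : A →ₗ[R] B) :
    Function.Injective (f.baseChange R') ↔
      Function.Injective ((f.restrictScalars S).lTensor S') := by
  let eA := Algebra.IsPushout.cancelBaseChange S S' R R' A
  let eB := Algebra.IsPushout.cancelBaseChange S S' R R' B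
  have h : ∀ x, f.baseChange R' (eA.symm x) = eB.symm ((f.restrictScalars S).lTensor S' x) := by
    intro x
    induction x with
    | zero => simp
    | add x y hx hy => simp only [map_add, hx, hy]
    | tmul s a => simp [eA, eB]
  have : f.baseChange R' ∘ eA.symm = eB.symm ∘ (f.restrictScalars S).lTensor S' := funext h
  rw [← EquivLike.comp_injective _ eB.symm, ← this, EquivLike.injective_comp]

variable (S S' R') in
lemma IsPureInjective.baseChange_injective [Algebra.IsPushout S S' R R'] {f : A →ₗ[R] B}
    (hf : IsPureInjective (f.restrictScalars S)) : Function.Injective (f.baseChange R') :=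
  (injective_baseChange_iff S S' R' f).2 (hf S')

variable {i : A →ₗ[R] B} {p : B →ₗ[R] C}

variable (S) in
lemma IsSES.isPureInjective [Module.Flat S C] (h : IsSES i p) :
    IsPureInjective (i.restrictScalars S) :=
  isPureInjective_of_flat (g := p.restrictScalars S) h.inj h.exact h.surj

variable (S S' R') in
lemma IsSES.baseChange [Algebra.IsPushout S S' R R'] [Module.Flat S C] (h : IsSES i p) :
    IsSES (i.baseChange R') (p.baseChange R') :=
  ⟨(h.isPureInjective S).baseChange_injective S S' R', lTensor_exact R' h.exact h.surj,
    LinearMap.lTensor_surjective R' h.surj⟩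

variable (S) in
lemma IsSES.flat_left [Module.Flat S B] [Module.Flat S C] (h : IsSES i p) : Module.Flat S A :=
  (h.isPureInjective S).flat_left

end BaseChange

section DualFlat

variable {S R : Type u} [CommRing S] [CommRing R] [Algebra S R] [IsNoetherianRing R]
  [Module.Flat S R] {N : Type u} [AddCommGroup N] [Module R N] [Module S N] [IsScalarTower S R N]
  [Module.Finite R N] [Module.Flat S N]

attribute [local instance] Algebra.TensorProduct.rightAlgebra

variable (S R N) in
/-- The first `Ext` of the fibres of `N` over the images of the closed points vanishes. -/
def FibreExtZero (i : ℕ) : Prop :=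
  ∀ m : Ideal R, m.IsMaximal → ∀ (p : Ideal S) [p.IsPrime], p = m.comap (algebraMap S R) →
    ExtZero (R ⊗[S] p.ResidueField) ((R ⊗[S] p.ResidueField) ⊗[R] N) (R ⊗[S] p.ResidueField) i

/-- Cohomology and base change in degree one. With B the image of P₀* in P₁*, vanishing of Ext¹
after base change is injectivity of P₁*/B → P₂* after base change. The local criterion makes this
map universally injective, so P₁*/B, then B, then N* = ker(P₀* → B) are flat, and 0 → N* → P₀* → B →
0 stays exact under base change. -/
theorem dual_flat_of_fibreExtZero (h : FibreExtZero S R N 1) :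
    Module.Flat S (Module.Dual R N) ∧
    ∀ (S' R' : Type u) [CommRing S'] [CommRing R'] [Algebra S S'] [Algebra R R'] [Algebra S' R']
      [Algebra S R'] [IsScalarTower S R R'] [IsScalarTower S S' R'] [Algebra.IsPushout S S' R R'],
      Function.Bijective (dualComparison R R' N) ∧ ExtZero R' (R' ⊗[R] N) R' 1 := by
  obtain ⟨n₀, p₀, hp₀⟩ := Module.Finite.exists_fin' R N
  obtain ⟨n₁, p₁, hp₁⟩ := Module.Finite.exists_fin' R (LinearMap.ker p₀)
  obtain ⟨n₂, p₂, hp₂⟩ := Module.Finite.exists_fin' R (LinearMap.ker p₁)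
  have h₀ := IsSES.of_surjective hp₀
  have h₁ := IsSES.of_surjective hp₁
  have hfl (n : ℕ) : Module.Flat S (Fin n → R) := Module.Flat.trans S R _
  have hK₁ : Module.Flat S (LinearMap.ker p₀) := h₀.flat_left S
  have hK₂ : Module.Flat S (LinearMap.ker p₁) := h₁.flat_left S
  have hfd (n : ℕ) : Module.Flat S (Module.Dual R (Fin n → R)) := Module.Flat.trans S R _
  let d₁ := (LinearMap.ker p₀).subtype ∘ₗ p₁
  let d₂ := (LinearMap.ker p₁).subtype ∘ₗ p₂
  have hdd : ∀ φ, d₂.dualMap (d₁.dualMap φ) = 0 := fun φ => by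
    ext x
    have := h₁.exact.apply_apply_eq_zero (p₂ x)
    simp [d₁, d₂]
  let B := LinearMap.range d₁.dualMap
  let f : (Module.Dual R (Fin n₁ → R) ⧸ B) →ₗ[R] Module.Dual R (Fin n₂ → R) :=
    B.liftQ d₂.dualMap (by rintro _ ⟨φ, rfl⟩; exact hdd φ)
  have hf (φ) : f (B.mkQ φ) = d₂.dualMap φ := rfl
  have hex : Function.Exact d₁.dualMap B.mkQ := LinearMap.exact_map_mkQ_range _
  -- the dual complex after base change
  have hE : ∀ (S' R' : Type u) [CommRing S'] [CommRing R'] [Algebra S S'] [Algebra R R']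
      [Algebra S' R'] [Algebra S R'] [IsScalarTower S R R'] [IsScalarTower S S' R']
      [Algebra.IsPushout S S' R R'], (ExtZero R' (R' ⊗[R] N) R' 1 ↔
        Function.Exact (d₁.baseChange R').dualMap (d₂.baseChange R').dualMap) := by
    intro S' R' _ _ _ _ _ _ _ _ _
    have := extZero_one_iff_exact_dual (h₀.baseChange S S' R') (h₁.baseChange S S' R')
      (p₂ := p₂.baseChange R') (LinearMap.lTensor_surjective R' hp₂)
    rwa [← LinearMap.baseChange_comp, ← LinearMap.baseChange_comp] at this
  have hd (R' : Type u) [CommRing R'] [Algebra R R'] (n : ℕ) :=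
    dualComparison_bijective_of_free (R := R) R' (M := Fin n → R)
  have hdual : ∀ (R' : Type u) [CommRing R'] [Algebra R R'],
      (Function.Exact (d₁.baseChange R').dualMap (d₂.baseChange R').dualMap ↔
        Function.Injective (f.baseChange R')) := by
    intro R' _ _
    have hex' := lTensor_exact R' hex B.mkQ_surjective
    have hf' (w) : f.baseChange R' (B.mkQ.baseChange R' w) = d₂.dualMap.baseChange R' w := by
      rw [← LinearMap.comp_apply, ← LinearMap.baseChange_comp]; rfl
    constructor
    · intro hx
      rw [injective_iff_map_eq_zero]
      intro z hz
      obtain ⟨w, rfl⟩ := LinearMap.lTensor_surjective _ B.mkQ_surjective z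
      have h1 : (d₂.baseChange R').dualMap (dualComparison R R' _ w) = 0 := by
        rw [← dualComparison_naturality, ← hf']
        exact (congrArg _ hz).trans (map_zero _)
      obtain ⟨ψ, hψ⟩ := (hx _).1 h1
      obtain ⟨v, rfl⟩ := (hd R' n₀).2 ψ
      rw [← dualComparison_naturality] at hψ
      rw [← (hd R' n₁).1 hψ]
      exact hex'.apply_apply_eq_zero v
    · intro hinj φ
      constructor
      · intro hφ
        obtain ⟨w, rfl⟩ := (hd R' n₁).2 φ
        rw [← dualComparison_naturality, ← hf'] at hφ
        have h1 : B.mkQ.baseChange R' w = 0 :=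
          hinj ((hd R' n₂).1 (hφ.trans (by rw [map_zero, map_zero])))
        obtain ⟨v, rfl⟩ := (hex' w).1 h1
        exact ⟨dualComparison R R' _ v, (dualComparison_naturality _ _ _).symm⟩
      · rintro ⟨ψ, rfl⟩
        obtain ⟨v, rfl⟩ := (hd R' n₀).2 ψ
        have h1 : d₂.dualMap.baseChange R' ∘ₗ d₁.dualMap.baseChange R' = 0 := by
          rw [← LinearMap.baseChange_comp, show d₂.dualMap ∘ₗ d₁.dualMap = 0 from LinearMap.ext hdd,
            LinearMap.baseChange_zero]
        have h2 := LinearMap.congr_fun h1 v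
        rw [LinearMap.comp_apply, LinearMap.zero_apply] at h2
        rw [← dualComparison_naturality, ← dualComparison_naturality, h2, map_zero]
  -- The source P₁*/B is not yet known to be flat. The criterion needs only that it is finite over R
  -- and that the target P₂* is S-flat.
  have hpure : IsPureInjective (f.restrictScalars S) := by
    refine isPureInjective_of_residueField f fun m hm p _ hp => ?_
    rw [← injective_baseChange_iff S p.ResidueField (R ⊗[S] p.ResidueField), ← hdual]
    exact (hE p.ResidueField (R ⊗[S] p.ResidueField)).1 (h m hm p hp)
  have hC : Module.Flat S (Module.Dual R (Fin n₁ → R) ⧸ B) := hpure.flat_left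
  have hB := IsSES.of_submodule B
  have hBfl : Module.Flat S B := IsSES.flat_left (A := B) S hB
  have hD : IsSES p₀.dualMap d₁.dualMap.rangeRestrict := by
    refine ⟨LinearMap.dualMap_injective_of_surjective hp₀, fun φ => ⟨fun hφ => ?_, ?_⟩,
      LinearMap.surjective_rangeRestrict _⟩
    · have h1 : d₁.dualMap φ = 0 := congrArg Subtype.val hφ
      exact exists_comp_eq_of_ses h₀ φ (by
        ext x
        obtain ⟨y, rfl⟩ := hp₁ x
        exact LinearMap.congr_fun h1 y)
    · rintro ⟨ψ, rfl⟩
      ext x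
      simp [d₁]
  refine ⟨IsSES.flat_left (C := B) S hD, fun S' R' _ _ _ _ _ _ _ _ _ => ?_⟩
  refine ⟨?_, (hE S' R').2 ((hdual R').2 (hpure.baseChange_injective S S' R'))⟩
  have hD' := IsSES.baseChange (C := B) (h := hD) S S' R'
  have hp₀' : Function.Injective (p₀.baseChange R').dualMap :=
    LinearMap.dualMap_injective_of_surjective (LinearMap.lTensor_surjective R' hp₀)
  constructor
  · intro x y hxy
    apply hD'.inj
    apply (hd R' n₀).1
    rw [dualComparison_naturality, hxy, dualComparison_naturality]
  · intro g
    obtain ⟨w, hw⟩ := (hd R' n₀).2 ((p₀.baseChange R').dualMap g)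
    have h1 : d₁.dualMap.rangeRestrict.baseChange R' w = 0 := by
      apply (IsSES.isPureInjective (A := B) S hB).baseChange_injective S S' R'
      rw [← LinearMap.comp_apply, ← LinearMap.baseChange_comp, map_zero]
      change d₁.dualMap.baseChange R' w = 0
      apply (hd R' n₁).1
      rw [dualComparison_naturality, hw, map_zero]
      have h2 : p₀.baseChange R' ∘ₗ d₁.baseChange R' = 0 := by
        rw [← LinearMap.baseChange_comp]
        have : p₀ ∘ₗ d₁ = 0 := by ext; simp [d₁]
        rw [this, LinearMap.baseChange_zero]
      ext x
      simpa using congrArg g (LinearMap.congr_fun h2 (1 ⊗ₜ Pi.single x 1))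
    obtain ⟨v, rfl⟩ := (hD'.exact w).1 h1
    refine ⟨v, hp₀' ?_⟩
    rw [← dualComparison_naturality, hw]

end DualFlat

/-! ### Stably reflexive modules and their cosyzygies -/

section StablyReflexive

variable {A : Type u} [CommRing A] {M N : Type u} [AddCommGroup M] [AddCommGroup N]
  [Module A M] [Module A N] {n : ℕ}

variable (A) in
/-- `IsStablyReflexive` for unbundled modules. -/
def SR (n : ℕ) (M : Type u) [AddCommGroup M] [Module A M] : Prop :=
  Module.IsReflexive A M ∧ ∀ i : ℕ, 0 < i → i < n →
    ExtZero A M A i ∧ ExtZero A (Module.Dual A M) A i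

lemma SR.mono {m : ℕ} (h : SR A n M) (hmn : m ≤ n) : SR A m M :=
  ⟨h.1, fun i hi hin => h.2 i hi (by lia)⟩

lemma SR.of_retract (h : SR A n M) (f : N →ₗ[A] M) (g : M →ₗ[A] N)
    (hgf : g ∘ₗ f = LinearMap.id) : SR A n N := by
  have := h.1
  refine ⟨Module.IsReflexive.of_split f g hgf, fun i hi hin => ⟨(h.2 i hi hin).1.of_retract f g hgf,
    (h.2 i hi hin).2.of_retract g.dualMap f.dualMap ?_⟩⟩
  rw [LinearMap.dualMap_comp_dualMap, hgf, LinearMap.dualMap_id]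

lemma SR.congr (h : SR A n M) (e : M ≃ₗ[A] N) : SR A n N :=
  h.of_retract e.symm.toLinearMap e.toLinearMap (by ext; simp)

lemma isSES_inl_snd : IsSES (LinearMap.inl A M N) (LinearMap.snd A M N) :=
  ⟨LinearMap.inl_injective, .inl_snd, LinearMap.snd_surjective⟩

lemma ExtZero.prod {X : Type u} [AddCommGroup X] [Module A X] {i : ℕ} (hM : ExtZero A M X i)
    (hN : ExtZero A N X i) : ExtZero A (M × N) X i :=
  .X₂ isSES_inl_snd hM hN

lemma SR.prod (hM : SR A n M) (hN : SR A n N) : SR A n (M × N) := by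
  have := hM.1
  have := hN.1
  exact ⟨inferInstance, fun i hi hin => ⟨(hM.2 i hi hin).1.prod (hN.2 i hi hin).1,
    ((hM.2 i hi hin).2.prod (hN.2 i hi hin).2).congr (Module.dualProdDualEquivDual A M N)⟩⟩

lemma SR.of_projective [Module.Finite A M] [Module.Projective A M] : SR A n M := by
  refine ⟨inferInstance, fun i hi _ => ?_⟩
  obtain ⟨i, rfl⟩ := Nat.exists_eq_succ_of_ne_zero hi.ne'
  exact ⟨extZero_of_projective i, extZero_of_projective i⟩

/-- The cokernel of `M → Q^*` for a presentation `Q → M^*` of the dual of a stably reflexive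
module `M`. -/
lemma SR.cosyzygy {Q : Type u} [AddCommGroup Q] [Module A Q] [Module.Finite A Q]
    [Module.Projective A Q] (hn : 0 < n) (hM : SR A (n + 1) M) {π : Q →ₗ[A] Module.Dual A M}
    (hπ : Function.Surjective π) {j : M →ₗ[A] Module.Dual A Q} {c : Module.Dual A Q →ₗ[A] N}
    (h : IsSES j c) (hj : ∀ x q, j x q = π q x) : SR A n N := by
  have := hM.1
  -- Every functional on M is given by an element of Q, and evaluation at that element extends it to
  -- Q*.
  have hj' : j.dualMap ∘ₗ Module.Dual.eval A Q = π := by ext; simp [hj]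
  have h1 : ExtZero A N A 1 := by
    refine extZero_one_of_extend h fun φ => ?_
    obtain ⟨q, rfl⟩ := hπ φ
    exact ⟨Module.Dual.eval A Q q, LinearMap.congr_fun hj' q⟩
  have hd : IsSES c.dualMap j.dualMap := by
    refine ⟨LinearMap.dualMap_injective_of_surjective h.surj, fun φ => ⟨fun hφ => ?_, ?_⟩, ?_⟩
    · exact exists_comp_eq_of_ses h φ hφ
    · rintro ⟨ψ, rfl⟩
      ext x
      simp [h.exact.apply_apply_eq_zero x]
    · intro φ
      obtain ⟨q, rfl⟩ := hπ φ
      exact ⟨_, LinearMap.congr_fun hj' q⟩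
  refine ⟨⟨?_, ?_⟩, fun i hi hin => ⟨?_, ?_⟩⟩
  · rw [injective_iff_map_eq_zero]
    intro y hy
    obtain ⟨q, rfl⟩ := h.surj y
    obtain ⟨m, hm⟩ := exists_comp_eq_of_ses hd (Module.Dual.eval A _ q) hy
    obtain ⟨m, rfl⟩ := (Module.bijective_dual_eval A M).2 m
    have : j m = q := by
      apply (Module.bijective_dual_eval A (Module.Dual A Q)).1
      rw [← hm]; rfl
    rw [← this]
    exact h.exact.apply_apply_eq_zero m
  · intro g
    -- Surjectivity of biduality for N is where Ext¹(M*, A) = 0 enters: a functional on N* extends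
    -- to Q**, hence is evaluation at an element of Q*.
    obtain ⟨ψ, hψ⟩ := (hM.2 1 (by lia) (by lia)).2.exists_extend hd g
    obtain ⟨q, rfl⟩ := (Module.bijective_dual_eval A (Module.Dual A Q)).2 ψ
    exact ⟨c q, hψ⟩
  · obtain rfl | ⟨i, rfl⟩ : i = 1 ∨ ∃ k, i = k + 2 := by
      rcases i with _ | _ | i
      · simp at hi
      · simp
      · exact .inr ⟨i, rfl⟩
    · exact h1
    · exact (extZero_succ_iff h i).2 (hM.2 (i + 1) (by lia) (by lia)).1
  -- Here a level is lost: Ext^i(N*, A) injects into Ext^{i+1}(M*, A), so the range of degrees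
  -- shrinks by one.
  · obtain ⟨i, rfl⟩ := Nat.exists_eq_succ_of_ne_zero hi.ne'
    exact .X₁ hd (extZero_of_projective i) (hM.2 _ (by lia) (by lia)).2

end StablyReflexive

section Universal

variable (S R : Type u) [CommRing S] [CommRing R] [Algebra S R] (n : ℕ)
  (N : Type u) [AddCommGroup N] [Module R N]

/-- All base changes of `N` along homomorphisms `S → S'` are `n`-stably reflexive. -/
def UnivSR : Prop :=
  ∀ (S' R' : Type u) [CommRing S'] [CommRing R'] [Algebra S S'] [Algebra R R'] [Algebra S' R']
    [Algebra S R'] [IsScalarTower S R R'] [IsScalarTower S S' R'] [Algebra.IsPushout S S' R R'],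
    SR R' n (R' ⊗[R] N)

attribute [local instance] Algebra.TensorProduct.rightAlgebra

/-- The fibres of `N` over the images of the closed points are `n`-stably reflexive. -/
def FibreSR : Prop :=
  ∀ m : Ideal R, m.IsMaximal → ∀ (p : Ideal S) [p.IsPrime], p = m.comap (algebraMap S R) →
    SR (R ⊗[S] p.ResidueField) n ((R ⊗[S] p.ResidueField) ⊗[R] N)

variable {S R n N}

lemma UnivSR.fibreSR (h : UnivSR S R n N) : FibreSR S R n N :=
  fun _ _ p _ _ => h p.ResidueField (R ⊗[S] p.ResidueField)

lemma UnivSR.sr (h : UnivSR S R n N) : SR R n N :=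
  (h S R).congr (TensorProduct.lid R N)

lemma UnivSR.mono {m : ℕ} (h : UnivSR S R n N) (hmn : m ≤ n) : UnivSR S R m N :=
  fun S' R' _ _ _ _ _ _ _ _ _ => (h S' R').mono hmn

lemma UnivSR.of_retract {M : Type u} [AddCommGroup M] [Module R M] (h : UnivSR S R n M)
    (f : N →ₗ[R] M) (g : M →ₗ[R] N) (hgf : g ∘ₗ f = LinearMap.id) : UnivSR S R n N :=
  fun S' R' _ _ _ _ _ _ _ _ _ => (h S' R').of_retract (f.baseChange R') (g.baseChange R') (by
    rw [← LinearMap.baseChange_comp, hgf, LinearMap.baseChange_id])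

lemma UnivSR.prod {M : Type u} [AddCommGroup M] [Module R M] (hM : UnivSR S R n M)
    (hN : UnivSR S R n N) : UnivSR S R n (M × N) :=
  fun S' R' _ _ _ _ _ _ _ _ _ =>
    ((hM S' R').prod (hN S' R')).congr (TensorProduct.prodRight R R' R' M N).symm

lemma UnivSR.of_projective [Module.Finite R N] [Module.Projective R N] : UnivSR S R n N :=
  fun _ _ _ _ _ _ _ _ _ _ _ => SR.of_projective

lemma UnivSR.baseChange (h : UnivSR S R n N) (S' R' : Type u) [CommRing S'] [CommRing R']
    [Algebra S S'] [Algebra R R'] [Algebra S' R'] [Algebra S R'] [IsScalarTower S R R']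
    [IsScalarTower S S' R'] [Algebra.IsPushout S S' R R'] : UnivSR S' R' n (R' ⊗[R] N) := by
  intro S'' R'' _ _ _ _ _ _ _ _ _
  let _ : Algebra S S'' := ((algebraMap S' S'').comp (algebraMap S S')).toAlgebra
  let _ : Algebra R R'' := ((algebraMap R' R'').comp (algebraMap R R')).toAlgebra
  let _ : Algebra S R'' := ((algebraMap R' R'').comp (algebraMap S R')).toAlgebra
  have : IsScalarTower S S' S'' := .of_algebraMap_eq fun _ => rfl
  have : IsScalarTower R R' R'' := .of_algebraMap_eq fun _ => rfl
  have : IsScalarTower S R' R'' := .of_algebraMap_eq fun _ => rfl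
  have : IsScalarTower S R R'' := .of_algebraMap_eq fun x => by
    rw [IsScalarTower.algebraMap_apply S R' R'', IsScalarTower.algebraMap_apply S R R',
      ← IsScalarTower.algebraMap_apply R R' R'']
  have : IsScalarTower S S'' R'' := .of_algebraMap_eq fun x => by
    rw [IsScalarTower.algebraMap_apply S R' R'', IsScalarTower.algebraMap_apply S S' R',
      ← IsScalarTower.algebraMap_apply S' R' R'', IsScalarTower.algebraMap_apply S' S'' R'',
      ← IsScalarTower.algebraMap_apply S S' S'']
  have : Algebra.IsPushout S S'' R R'' := (Algebra.IsPushout.comp_iff (R := S) (S := S') (R' := R)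
    (S' := R')).2 inferInstance
  exact (h S'' R'').congr (AlgebraTensorModule.cancelBaseChange R R' R'' R'' N).symm

end Universal

/-! ### From fibres to all base changes -/

section FibreToUniversal

lemma eval_baseChange_comp {R N : Type u} [CommRing R] [AddCommGroup N] [Module R N] (R' : Type u)
    [CommRing R'] [Algebra R R'] :
    (dualComparison R R' N).dualMap ∘ₗ Module.Dual.eval R' (R' ⊗[R] N) =
      dualComparison R R' (Module.Dual R N) ∘ₗ (Module.Dual.eval R N).baseChange R' := by
  ext x f
  simp

variable {S R : Type u} [CommRing S] [CommRing R] [Algebra S R] [IsNoetherianRing R]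

attribute [local instance] Algebra.TensorProduct.rightAlgebra

instance finite_dual (N : Type u) [AddCommGroup N] [Module R N] [Module.Finite R N] :
    Module.Finite R (Module.Dual R N) := by
  obtain ⟨k, p, hp⟩ := Module.Finite.exists_fin' R N
  exact Module.Finite.of_injective p.dualMap (LinearMap.dualMap_injective_of_surjective hp)

-- A form of Nakayama's lemma: the cokernel has zero fibres, so the local criterion applies to its
-- map to zero and shows that this map is injective.
variable (S) in
lemma surjective_of_fibre {A B : Type u} [AddCommGroup A] [AddCommGroup B] [Module R A]
    [Module R B] [Module S A] [Module S B] [IsScalarTower S R A] [IsScalarTower S R B]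
    [Module.Finite R B] (f : A →ₗ[R] B)
    (h : ∀ m : Ideal R, m.IsMaximal → ∀ (p : Ideal S) [p.IsPrime], p = m.comap (algebraMap S R) →
      Function.Surjective (f.baseChange (R ⊗[S] p.ResidueField))) : Function.Surjective f := by
  have h1 : IsPureInjective ((0 : (B ⧸ LinearMap.range f) →ₗ[R] PUnit.{u + 1}).restrictScalars S)
      := by
    refine isPureInjective_of_residueField _ fun m hm p _ hp => ?_
    rw [← injective_baseChange_iff S p.ResidueField (R ⊗[S] p.ResidueField)]
    have h2 := lTensor_exact (R ⊗[S] p.ResidueField)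
      (LinearMap.exact_map_mkQ_range f) (Submodule.mkQ_surjective _)
    rw [injective_iff_map_eq_zero]
    intro z _
    obtain ⟨w, rfl⟩ := LinearMap.lTensor_surjective _ (Submodule.mkQ_surjective _) z
    obtain ⟨y, rfl⟩ := h m hm p hp w
    exact h2.apply_apply_eq_zero y
  intro x
  have h2 : (Submodule.Quotient.mk x : B ⧸ LinearMap.range f) = 0 :=
    h1.injective (Subsingleton.elim _ _)
  rwa [Submodule.Quotient.mk_eq_zero] at h2

lemma baseChange_bijective {R A B : Type u} [CommRing R] [AddCommGroup A] [AddCommGroup B]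
    [Module R A] [Module R B] {f : A →ₗ[R] B} (hf : Function.Bijective f) (R' : Type u)
    [CommRing R'] [Algebra R R'] : Function.Bijective (f.baseChange R') :=
  ((LinearEquiv.ofBijective f hf).baseChange R R' A B).bijective

variable [Module.Flat S R]

/-- Higher degrees reduce to degree one by passing to syzygies, which stay S-flat and commute with
base change. -/
lemma extZero_of_fibreExtZero (i : ℕ) : ∀ (N : Type u) [AddCommGroup N] [Module R N] [Module S N]
    [IsScalarTower S R N] [Module.Finite R N] [Module.Flat S N], FibreExtZero S R N (i + 1) →
    ∀ (S' R' : Type u) [CommRing S'] [CommRing R'] [Algebra S S'] [Algebra R R'] [Algebra S' R']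
      [Algebra S R'] [IsScalarTower S R R'] [IsScalarTower S S' R'] [Algebra.IsPushout S S' R R'],
      ExtZero R' (R' ⊗[R] N) R' (i + 1) := by
  induction i with
  | zero =>
    intro N _ _ _ _ _ _ h S' R' _ _ _ _ _ _ _ _ _
    exact ((dual_flat_of_fibreExtZero h).2 S' R').2
  | succ i ih =>
    intro N _ _ _ _ _ _ h S' R' _ _ _ _ _ _ _ _ _
    obtain ⟨k, p, hp⟩ := Module.Finite.exists_fin' R N
    have hs := IsSES.of_surjective hp
    have : Module.Flat S (Fin k → R) := Module.Flat.trans S R _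
    have := hs.flat_left S
    refine (extZero_succ_iff (hs.baseChange S S' R') i).2 (ih _ ?_ S' R')
    intro m hm p _ hpm
    exact (extZero_succ_iff (hs.baseChange S p.ResidueField _) i).1 (h m hm p hpm)

variable {N : Type u} [AddCommGroup N] [Module R N]

variable [Module S N] [IsScalarTower S R N] [Module.Finite R N] [Module.Flat S N] {n : ℕ}

/-- The hypothesis `1 < n` supplies Ext¹ = 0 for the fibres of N, so N* is flat and commutes with
base change; the fibres of N* are then the duals of the fibres, and the same applies to N**.
Biduality therefore commutes with base change. Being bijective on fibres, it is injective by the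
local criterion and surjective by Nakayama. -/
theorem FibreSR.univSR_aux (hn : 1 < n) (h : FibreSR S R n N) :
    UnivSR S R n N ∧ Module.Flat S (Module.Dual R N) ∧
    ∀ (S' R' : Type u) [CommRing S'] [CommRing R'] [Algebra S S'] [Algebra R R'] [Algebra S' R']
      [Algebra S R'] [IsScalarTower S R R'] [IsScalarTower S S' R'] [Algebra.IsPushout S S' R R'],
      Function.Bijective (dualComparison R R' N) := by
  have hext : ∀ i, 0 < i → i < n → FibreExtZero S R N i := fun i hi hin m hm p _ hp =>
    ((h m hm p hp).2 i hi hin).1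
  obtain ⟨hflat, hcomp⟩ := dual_flat_of_fibreExtZero (hext 1 (by lia) hn)
  have hext' : ∀ i, 0 < i → i < n → FibreExtZero S R (Module.Dual R N) i := fun i hi hin m hm p _
      hp =>
    ((h m hm p hp).2 i hi hin).2.congr (LinearEquiv.ofBijective _
      (hcomp p.ResidueField (R ⊗[S] p.ResidueField)).1).symm
  obtain ⟨hflat', hcomp'⟩ := dual_flat_of_fibreExtZero (hext' 1 (by lia) hn)
  have heval : ∀ (S' R' : Type u) [CommRing S'] [CommRing R'] [Algebra S S'] [Algebra R R']
      [Algebra S' R'] [Algebra S R'] [IsScalarTower S R R'] [IsScalarTower S S' R']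
      [Algebra.IsPushout S S' R R'],
      (Function.Bijective (Module.Dual.eval R' (R' ⊗[R] N)) ↔
        Function.Bijective ((Module.Dual.eval R N).baseChange R')) := by
    intro S' R' _ _ _ _ _ _ _ _ _
    have h1 := congrArg DFunLike.coe (eval_baseChange_comp (R := R) (N := N) R')
    rw [LinearMap.coe_comp, LinearMap.coe_comp] at h1
    rw [← (hcomp' S' R').1.of_comp_iff', ← h1, Function.Bijective.of_comp_iff']
    exact (LinearEquiv.ofBijective _ (hcomp S' R').1).dualMap.bijective
  have hfib : ∀ m : Ideal R, m.IsMaximal → ∀ (p : Ideal S) [p.IsPrime],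
      p = m.comap (algebraMap S R) → Function.Bijective
        ((Module.Dual.eval R N).baseChange (R ⊗[S] p.ResidueField)) := fun m hm p _ hp =>
            (heval p.ResidueField (R ⊗[S] p.ResidueField)).1
    (h m hm p hp).1.bijective_dual_eval'
  have hinj : IsPureInjective ((Module.Dual.eval R N).restrictScalars S) := by
    refine isPureInjective_of_residueField _ fun m hm p _ hp => ?_
    rw [← injective_baseChange_iff S p.ResidueField (R ⊗[S] p.ResidueField)]
    exact (hfib m hm p hp).1
  have hsurj : Function.Surjective (Module.Dual.eval R N) :=
    surjective_of_fibre S _ fun m hm p _ hp => (hfib m hm p hp).2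
  refine ⟨fun S' R' _ _ _ _ _ _ _ _ _ => ⟨⟨?_⟩, fun i hi hin => ?_⟩, hflat, fun S' R' _ _ _ _ _ _ _
      _ _ =>
    (hcomp S' R').1⟩
  · exact (heval S' R').2 (baseChange_bijective (f := Module.Dual.eval R N) ⟨hinj.injective, hsurj⟩
      R')
  · obtain ⟨i, rfl⟩ := Nat.exists_eq_succ_of_ne_zero hi.ne'
    exact ⟨extZero_of_fibreExtZero i N (hext _ hi hin) S' R',
      (extZero_of_fibreExtZero i _ (hext' _ hi hin) S' R').congr
        (LinearEquiv.ofBijective _ (hcomp S' R').1)⟩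

lemma FibreSR.univSR (hn : 1 < n) (h : FibreSR S R n N) : UnivSR S R n N :=
  (h.univSR_aux hn).1

/-- A stably reflexive module embeds in a finite projective module with stably reflexive
cokernel. -/
theorem UnivSR.exists_cosyzygy (hn : 0 < n) (h : UnivSR S R (n + 1) N) :
    ∃ (P N' : Type u) (_ : AddCommGroup P) (_ : AddCommGroup N') (_ : Module R P) (_ : Module R N')
      (j : N →ₗ[R] P) (c : P →ₗ[R] N'), IsSES j c ∧ Module.Finite R P ∧ Module.Projective R P ∧
        UnivSR S R n N' ∧ (∀ f : N →ₗ[R] R, ∃ g : P →ₗ[R] R, g ∘ₗ j = f) ∧ ∀ [Module S N']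
            [IsScalarTower S R N'], Module.Flat S N' := by
  obtain ⟨-, hflat, hcomp⟩ := h.fibreSR.univSR_aux (by lia)
  -- Since N* commutes with base change, this one free cover of N* remains a cover of the dual after
  -- base change, so a single embedding N → Q* serves all base changes.
  obtain ⟨k, π, hπ⟩ := Module.Finite.exists_fin' R (Module.Dual R N)
  let Q := Fin k → R
  let j : N →ₗ[R] Module.Dual R Q := π.dualMap ∘ₗ Module.Dual.eval R N
  let N' := Module.Dual R Q ⧸ LinearMap.range j
  have hQ : Function.Surjective (LinearMap.range j).mkQ := Submodule.mkQ_surjective _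
  have hjc : Function.Exact j (LinearMap.range j).mkQ := LinearMap.exact_map_mkQ_range j
  have key : ∀ (S' R' : Type u) [CommRing S'] [CommRing R'] [Algebra S S'] [Algebra R R']
      [Algebra S' R'] [Algebra S R'] [IsScalarTower S R R'] [IsScalarTower S S' R']
      [Algebra.IsPushout S S' R R'], Function.Injective (j.baseChange R') ∧
      SR R' n (R' ⊗[R] N') := by
    intro S' R' _ _ _ _ _ _ _ _ _
    have hsr := h S' R'
    have := hsr.1
    let δ := LinearEquiv.ofBijective _ (dualComparison_bijective_of_free (R := R) R' (M := Q))
    let π' := dualComparison R R' N ∘ₗ π.baseChange R'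
    have hπ' : Function.Surjective π' :=
      (hcomp S' R').2.comp (LinearMap.lTensor_surjective R' hπ)
    let j' := δ.toLinearMap ∘ₗ j.baseChange R'
    have hj' : j' = π'.dualMap ∘ₗ Module.Dual.eval R' (R' ⊗[R] N) := by
      ext x q
      simp [j', j, δ, π']
    have hinj : Function.Injective j' := by
      rw [hj']
      exact (LinearMap.dualMap_injective_of_surjective hπ').comp
        (Module.bijective_dual_eval R' _).1
    have hex := lTensor_exact R' hjc hQ
    have hses : IsSES j' ((LinearMap.range j).mkQ.baseChange R' ∘ₗ δ.symm.toLinearMap) := by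
      refine ⟨hinj, fun φ => ?_, (LinearMap.lTensor_surjective R' hQ).comp δ.symm.surjective⟩
      obtain ⟨w, rfl⟩ := δ.surjective φ
      refine Iff.trans (by simp [LinearMap.baseChange_eq_ltensor]) ((hex w).trans ?_)
      constructor
      · rintro ⟨y, rfl⟩
        exact ⟨y, rfl⟩
      · rintro ⟨y, hy⟩
        exact ⟨y, δ.injective hy⟩
    exact ⟨fun x y hxy => hinj (congrArg δ hxy),
      hsr.cosyzygy hn hπ' hses fun x q => by rw [hj']; rfl⟩
  have hj : Function.Injective j := by
    have h1 := (injective_baseChange_iff S S R j).1 (key S R).1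
    intro x y hxy
    have : (1 : S) ⊗ₜ[S] x = 1 ⊗ₜ y := h1 (by simp [hxy])
    simpa using congrArg (TensorProduct.lid S N) this
  refine ⟨Module.Dual R Q, N', inferInstance, inferInstance, inferInstance, inferInstance, j, _,
    ⟨hj, hjc, hQ⟩, inferInstance, inferInstance, fun S' R' _ _ _ _ _ _ _ _ _ => (key S' R').2,
    fun f => ?_, ?_⟩
  · obtain ⟨q, rfl⟩ := hπ f
    exact ⟨Module.Dual.eval R Q q, rfl⟩
  intro _ _
  have : Module.Flat S (Module.Dual R Q) := Module.Flat.trans S R _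
  have hp : IsPureInjective (j.restrictScalars S) := by
    refine isPureInjective_of_residueField _ fun m hm p _ hp => ?_
    rw [← injective_baseChange_iff S p.ResidueField (R ⊗[S] p.ResidueField)]
    exact (key p.ResidueField _).1
  exact hp.flat_of_exact (g := (LinearMap.range j).mkQ.restrictScalars S) hjc hQ

end FibreToUniversal

/-! ### Relative flatness and the categories in unbundled form -/

section FlatOver

variable (S R : Type u) [CommRing S] [CommRing R] [Algebra S R]

/-- Flatness over `S` of an `R`-module, for its unique compatible `S`-module structure. -/
def FlatOver (N : Type u) [AddCommGroup N] [Module R N] : Prop :=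
  letI : Module S N := Module.compHom N (algebraMap S R)
  Module.Flat S N

variable {S R} {L M N : Type u} [AddCommGroup L] [AddCommGroup M] [AddCommGroup N] [Module R L]
  [Module R M] [Module R N]

lemma flatOver_iff [i : Module S N] [IsScalarTower S R N] :
    FlatOver S R N ↔ Module.Flat S N := by
  have : Module.compHom N (algebraMap S R) = i := by
    refine Module.ext' _ _ fun s x => ?_
    exact algebraMap_smul R s x
  rw [FlatOver, this]

/-- The compatible `S`-module structure of an `R`-module. -/
lemma exists_module_tower (S R : Type u) [CommRing S] [CommRing R] [Algebra S R] (N : Type u)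
    [AddCommGroup N] [Module R N] :
    ∃ _ : Module S N, IsScalarTower S R N :=
  ⟨Module.compHom N (algebraMap S R), by
    let _ : Module S N := Module.compHom N (algebraMap S R)
    exact ⟨fun s r x => by rw [Algebra.smul_def, mul_smul]; rfl⟩⟩

lemma FlatOver.of_retract (h : FlatOver S R M) (f : N →ₗ[R] M) (g : M →ₗ[R] N)
    (hgf : g ∘ₗ f = LinearMap.id) : FlatOver S R N := by
  obtain ⟨_, _⟩ := exists_module_tower S R M
  obtain ⟨_, _⟩ := exists_module_tower S R N
  rw [flatOver_iff] at h ⊢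
  exact Module.Flat.of_retract (f.restrictScalars S) (g.restrictScalars S)
    (LinearMap.ext fun x => LinearMap.congr_fun hgf x)

lemma FlatOver.prod (hM : FlatOver S R M) (hN : FlatOver S R N) : FlatOver S R (M × N) := by
  obtain ⟨_, _⟩ := exists_module_tower S R M
  obtain ⟨_, _⟩ := exists_module_tower S R N
  rw [flatOver_iff] at hM hN ⊢
  refine Module.Flat.iff_lTensor_preserves_injective_linearMap.2 fun P Q _ _ _ _ f hf => ?_
  rw [injective_iff_map_eq_zero]
  intro x hx
  have h1 : (LinearMap.fst S M N).rTensor P x = 0 := by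
    refine (injective_iff_map_eq_zero _).1 (Module.Flat.lTensor_preserves_injective_linearMap f hf)
        _ ?_
    rw [← LinearMap.comp_apply, LinearMap.lTensor_comp_rTensor, ← LinearMap.rTensor_comp_lTensor,
      LinearMap.comp_apply, hx, map_zero]
  have h2 : (LinearMap.snd S M N).rTensor P x = 0 := by
    refine (injective_iff_map_eq_zero _).1 (Module.Flat.lTensor_preserves_injective_linearMap f hf)
        _ ?_
    rw [← LinearMap.comp_apply, LinearMap.lTensor_comp_rTensor, ← LinearMap.rTensor_comp_lTensor,
      LinearMap.comp_apply, hx, map_zero]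
  have h3 : LinearMap.inl S M N ∘ₗ LinearMap.fst S M N + LinearMap.inr S M N ∘ₗ
      LinearMap.snd S M N = LinearMap.id := by
    ext <;> simp
  have h4 := congrArg (fun g => g.rTensor P x) h3
  simpa [LinearMap.rTensor_add, LinearMap.rTensor_comp, h1, h2, eq_comm] using h4

lemma FlatOver.of_projective [Module.Flat S R] [Module.Projective R N] : FlatOver S R N := by
  obtain ⟨_, _⟩ := exists_module_tower S R N
  rw [flatOver_iff]
  exact Module.Flat.trans S R N

lemma FlatOver.left {i : L →ₗ[R] M} {p : M →ₗ[R] N} (h : IsSES i p) (hM : FlatOver S R M)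
    (hN : FlatOver S R N) : FlatOver S R L := by
  obtain ⟨_, _⟩ := exists_module_tower S R L
  obtain ⟨_, _⟩ := exists_module_tower S R M
  obtain ⟨_, _⟩ := exists_module_tower S R N
  rw [flatOver_iff] at hM hN ⊢
  exact h.flat_left S

lemma FlatOver.baseChange (h : FlatOver S R N) (S' R' : Type u) [CommRing S'] [CommRing R']
    [Algebra S S'] [Algebra R R'] [Algebra S' R'] [Algebra S R'] [IsScalarTower S R R']
    [IsScalarTower S S' R'] [Algebra.IsPushout S S' R R'] : FlatOver S' R' (R' ⊗[R] N) := by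
  obtain ⟨_, _⟩ := exists_module_tower S R N
  rw [flatOver_iff] at h ⊢
  exact Module.Flat.of_linearEquiv (Algebra.IsPushout.cancelBaseChange S S' R R' N)

lemma IsSES.baseChange_of_flatOver {i : L →ₗ[R] M} {p : M →ₗ[R] N} (h : IsSES i p)
    (hN : FlatOver S R N) (S' R' : Type u) [CommRing S'] [CommRing R']
    [Algebra S S'] [Algebra R R'] [Algebra S' R'] [Algebra S R'] [IsScalarTower S R R']
    [IsScalarTower S S' R'] [Algebra.IsPushout S S' R R'] :
    IsSES (i.baseChange R') (p.baseChange R') := by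
  obtain ⟨_, _⟩ := exists_module_tower S R L
  obtain ⟨_, _⟩ := exists_module_tower S R M
  obtain ⟨_, _⟩ := exists_module_tower S R N
  rw [flatOver_iff] at hN
  exact h.baseChange S S' R'

end FlatOver

section Categories

variable (S R : Type u) [CommRing S] [CommRing R] [Algebra S R]

/-- Finite `S`-flat `R`-modules of projective dimension at most `n`. -/
structure InP (n : ℕ) (N : Type u) [AddCommGroup N] [Module R N] : Prop where
  finite : Module.Finite R N
  flat : FlatOver S R N
  pd : PdLE R N n

/-- Finite `S`-flat `R`-modules whose base changes are `n`-stably reflexive. -/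
structure InX (n : ℕ) (N : Type u) [AddCommGroup N] [Module R N] : Prop where
  finite : Module.Finite R N
  flat : FlatOver S R N
  univ : UnivSR S R n N

variable {S R} {L M N : Type u} [AddCommGroup L] [AddCommGroup M] [AddCommGroup N] [Module R L]
  [Module R M] [Module R N] {n : ℕ}

lemma PdLE.prod (hM : PdLE R M n) (hN : PdLE R N n) : PdLE R (M × N) n :=
  .X₂ isSES_inl_snd hM hN

lemma PdLE.of_projective [Module.Projective R N] : PdLE R N n :=
  (pdLE_zero_iff.2 inferInstance).of_le (Nat.zero_le n)

lemma InP.mono {m : ℕ} (h : InP S R m N) (hmn : m ≤ n) : InP S R n N :=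
  ⟨h.1, h.2, h.3.of_le hmn⟩

lemma InP.prod (hM : InP S R n M) (hN : InP S R n N) : InP S R n (M × N) :=
  have := hM.1
  have := hN.1
  ⟨inferInstance, hM.2.prod hN.2, hM.3.prod hN.3⟩

lemma InP.of_retract (h : InP S R n M) (f : N →ₗ[R] M) (g : M →ₗ[R] N)
    (hgf : g ∘ₗ f = LinearMap.id) : InP S R n N :=
  have := h.1
  ⟨Module.Finite.of_surjective g (LinearMap.surjective_of_comp_eq_id f g hgf),
    h.2.of_retract f g hgf, h.3.of_retract f g hgf⟩

lemma InP.of_projective [Module.Flat S R] [Module.Finite R N] [Module.Projective R N] :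
    InP S R n N :=
  ⟨inferInstance, .of_projective, .of_projective⟩

lemma InX.mono {m : ℕ} (h : InX S R m N) (hnm : n ≤ m) : InX S R n N :=
  ⟨h.1, h.2, h.3.mono hnm⟩

lemma InX.prod (hM : InX S R n M) (hN : InX S R n N) : InX S R n (M × N) :=
  have := hM.1
  have := hN.1
  ⟨inferInstance, hM.2.prod hN.2, hM.3.prod hN.3⟩

lemma InX.of_retract (h : InX S R n M) (f : N →ₗ[R] M) (g : M →ₗ[R] N)
    (hgf : g ∘ₗ f = LinearMap.id) : InX S R n N :=
  have := h.1
  ⟨Module.Finite.of_surjective g (LinearMap.surjective_of_comp_eq_id f g hgf),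
    h.2.of_retract f g hgf, h.3.of_retract f g hgf⟩

lemma InX.congr (h : InX S R n M) (e : M ≃ₗ[R] N) : InX S R n N :=
  h.of_retract e.symm.toLinearMap e.toLinearMap (by ext; simp)

lemma InX.of_projective [Module.Flat S R] [Module.Finite R N] [Module.Projective R N] :
    InX S R n N :=
  ⟨inferInstance, .of_projective, .of_projective⟩

lemma InX.extZero [IsNoetherianRing R] (h : InX S R n M) {d : ℕ} (hL : InP S R d L)
    (hd : d + 1 < n) : ExtZero R M L 1 :=
  have := hL.1
  .of_pdLE (fun j hj hjn => (h.3.sr.2 j hj hjn).1) d L hL.3 1 one_pos (by lia)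

/-- Besides its level `n`, the cokernel has Ext into R vanishing in all degrees below `n + 2`: in
degree one because functionals extend, above it by shifting from N. This surplus is needed for
minimality. -/
theorem InX.exists_cosyzygy [IsNoetherianRing R] [Module.Flat S R] (hn : 0 < n)
    (h : InX S R (n + 1) N) :
    ∃ (P N' : ModuleCat.{u} R) (j : N →ₗ[R] P) (c : P →ₗ[R] N'), IsSES j c ∧ Module.Finite R P ∧
      Module.Projective R P ∧ InX S R n N' ∧ ∀ i, 0 < i → i < n + 2 → ExtZero R N' R i := by
  obtain ⟨_, _⟩ := exists_module_tower S R N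
  have := h.finite
  have := flatOver_iff.1 h.flat
  obtain ⟨P, N', _, _, _, _, j, c, hjc, hfP, _, hN', hext, hfl⟩ := h.univ.exists_cosyzygy hn
  obtain ⟨_, _⟩ := exists_module_tower S R N'
  refine ⟨ModuleCat.of R P, ModuleCat.of R N', j, c, hjc, ‹_›, ‹_›,
    ⟨Module.Finite.of_surjective c hjc.surj, flatOver_iff.2 hfl, hN'⟩, fun i hi hin => ?_⟩
  obtain ⟨i, rfl⟩ := Nat.exists_eq_succ_of_ne_zero hi.ne'
  obtain _ | i := i
  · exact extZero_one_of_extend hjc hext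
  · exact (extZero_succ_iff hjc i).2 (h.univ.sr.2 (i + 1) (by lia) (by lia)).1

section BaseChange

variable (S' R' : Type u) [CommRing S'] [CommRing R']
    [Algebra S S'] [Algebra R R'] [Algebra S' R'] [Algebra S R'] [IsScalarTower S R R']
    [IsScalarTower S S' R'] [Algebra.IsPushout S S' R R']

lemma InX.baseChange (h : InX S R n N) : InX S' R' n (R' ⊗[R] N) :=
  have := h.1
  ⟨inferInstance, h.2.baseChange S' R', h.3.baseChange S' R'⟩

/-- All syzygies of an S-flat module over an S-flat ring are S-flat, so a projective resolution
stays exact after base change. -/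
lemma PdLE.baseChange (S S' R' : Type u) [CommRing S] [Algebra S R] [CommRing S'] [CommRing R']
    [Algebra S S'] [Algebra R R'] [Algebra S' R'] [Algebra S R'] [IsScalarTower S R R']
    [IsScalarTower S S' R'] [Algebra.IsPushout S S' R R'] [Module.Flat S R] (n : ℕ) : ∀
        (N : Type u) [AddCommGroup N] [Module R N],
    FlatOver S R N → PdLE R N n → PdLE R' (R' ⊗[R] N) n := by
  induction n with
  | zero =>
    intro N _ _ _ h
    have := pdLE_zero_iff.1 h
    exact .of_projective
  | succ n ih =>
    intro N _ _ hN h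
    obtain ⟨P, _, _, _, q, hq⟩ : ∃ (P : Type u) (_ : AddCommGroup P) (_ : Module R P)
        (_ : Module.Free R P) (q : P →ₗ[R] N), Function.Surjective q :=
      ⟨N →₀ R, inferInstance, inferInstance, inferInstance, Finsupp.linearCombination R id,
        Finsupp.linearCombination_id_surjective R N⟩
    have hs := IsSES.of_surjective hq
    exact .X₃ (hs.baseChange_of_flatOver hN S' R')
      (ih _ (.left hs .of_projective hN) (.X₁ hs .of_projective h)) .of_projective

lemma InP.baseChange [Module.Flat S R] (h : InP S R n N) : InP S' R' n (R' ⊗[R] N) :=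
  have := h.1
  ⟨inferInstance, h.2.baseChange S' R', PdLE.baseChange S S' R' n N h.2 h.3⟩

end BaseChange

end Categories

/-! ### Construction of the sequences (a) and (b) -/

section Sequences

variable (S R : Type u) [CommRing S] [CommRing R] [Algebra S R] (r d : ℕ)
  (N : Type u) [AddCommGroup N] [Module R N]

/-- There is a short exact sequence `0 → L → M → N → 0` with `L` of projective dimension at most
`d` and `M` stably reflexive. -/
def HasSeqA : Prop :=
  ∃ (L M : ModuleCat.{u} R) (i : L →ₗ[R] M) (p : M →ₗ[R] N), IsSES i p ∧ InP S R d L ∧ InX S R r M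

/-- There is a short exact sequence `0 → N → L → M → 0` with `L` of projective dimension at most
`d` and `M` stably reflexive. -/
def HasSeqB : Prop :=
  ∃ (L M : ModuleCat.{u} R) (j : N →ₗ[R] L) (q : L →ₗ[R] M), IsSES j q ∧ InP S R d L ∧ InX S R r M

variable {S R r d N} {N' : Type u} [AddCommGroup N'] [Module R N']

lemma IsSES.prod {K P K' P' : Type*} [AddCommGroup K] [AddCommGroup P] [AddCommGroup K']
    [AddCommGroup P'] [Module R K] [Module R P] [Module R K'] [Module R P'] {i : K →ₗ[R] P}
    {p : P →ₗ[R] N} {i' : K' →ₗ[R] P'} {p' : P' →ₗ[R] N'} (h : IsSES i p) (h' : IsSES i' p') :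
    IsSES (i.prodMap i') (p.prodMap p') := by
  refine ⟨h.inj.prodMap h'.inj, fun x => ?_, h.surj.prodMap h'.surj⟩
  constructor
  · intro hx
    obtain ⟨a, ha⟩ := (h.exact x.1).1 (congrArg Prod.fst hx)
    obtain ⟨b, hb⟩ := (h'.exact x.2).1 (congrArg Prod.snd hx)
    exact ⟨(a, b), Prod.ext ha hb⟩
  · rintro ⟨y, rfl⟩
    exact Prod.ext (h.exact.apply_apply_eq_zero y.1) (h'.exact.apply_apply_eq_zero y.2)

lemma HasSeqA.mono {d' : ℕ} (h : HasSeqA S R r d N) (hd : d ≤ d') : HasSeqA S R r d' N := by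
  obtain ⟨L, M, i, p, hs, hL, hM⟩ := h
  exact ⟨L, M, i, p, hs, hL.mono hd, hM⟩

lemma HasSeqB.mono {d' : ℕ} (h : HasSeqB S R r d N) (hd : d ≤ d') : HasSeqB S R r d' N := by
  obtain ⟨L, M, i, p, hs, hL, hM⟩ := h
  exact ⟨L, M, i, p, hs, hL.mono hd, hM⟩

lemma HasSeqA.congr (h : HasSeqA S R r d N) (e : N ≃ₗ[R] N') : HasSeqA S R r d N' := by
  obtain ⟨L, M, i, p, hs, hL, hM⟩ := h
  exact ⟨L, M, i, e.toLinearMap ∘ₗ p, ⟨hs.inj, fun x => by simpa using hs.exact x,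
    e.surjective.comp hs.surj⟩, hL, hM⟩

lemma HasSeqB.congr (h : HasSeqB S R r d N) (e : N ≃ₗ[R] N') : HasSeqB S R r d N' := by
  obtain ⟨L, M, j, q, hs, hL, hM⟩ := h
  refine ⟨L, M, j ∘ₗ e.symm.toLinearMap, q, ⟨hs.inj.comp e.symm.injective, fun x => ?_, hs.surj⟩,
    hL, hM⟩
  rw [hs.exact x]
  exact ⟨fun ⟨y, hy⟩ => ⟨e y, by simpa using hy⟩, fun ⟨y, hy⟩ => ⟨e.symm y, hy⟩⟩

lemma HasSeqA.prod (h : HasSeqA S R r d N) (h' : HasSeqA S R r d N') :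
    HasSeqA S R r d (N × N') := by
  obtain ⟨L, M, i, p, hs, hL, hM⟩ := h
  obtain ⟨L', M', i', p', hs', hL', hM'⟩ := h'
  exact ⟨.of R (L × L'), .of R (M × M'), _, _, hs.prod hs', hL.prod hL', hM.prod hM'⟩

lemma HasSeqB.prod (h : HasSeqB S R r d N) (h' : HasSeqB S R r d N') :
    HasSeqB S R r d (N × N') := by
  obtain ⟨L, M, i, p, hs, hL, hM⟩ := h
  obtain ⟨L', M', i', p', hs', hL', hM'⟩ := h'
  exact ⟨.of R (L × L'), .of R (M × M'), _, _, hs.prod hs', hL.prod hL', hM.prod hM'⟩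

variable [Module.Flat S R]

lemma InX.hasSeqA (h : InX S R r N) : HasSeqA S R r d N :=
  ⟨.of R PUnit, .of R N, 0, LinearMap.id, ⟨fun _ _ _ => rfl, fun x => by simp [eq_comm],
    Function.surjective_id⟩, .of_projective, h⟩

lemma InX.hasSeqB [IsNoetherianRing R] (hr : 0 < r) (h : InX S R (r + 1) N) :
    HasSeqB S R r d N := by
  obtain ⟨P, N', j, c, hs, _, _, hN', -⟩ := h.exists_cosyzygy hr
  exact ⟨P, N', j, c, hs, .of_projective, hN'⟩

/-- The sequence (b) obtained from a sequence (a). -/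
lemma HasSeqA.hasSeqB [IsNoetherianRing R] (hr : 0 < r) (hN : FlatOver S R N)
    (h : HasSeqA S R (r + 1) d N) : HasSeqB S R r (d + 1) N := by
  obtain ⟨L, M, i, p, hs, hL, hM⟩ := h
  obtain ⟨Q, M', j, c, hjc, _, _, hM', -⟩ := hM.exists_cosyzygy hr
  -- Embed M in a projective Q with cokernel M' and divide out L: N = M/L sits in Q/L with quotient
  -- Q/M = M'. Since L' = Q/L has L as a syzygy, its projective dimension is at most `d + 1`.
  let k : L →ₗ[R] Q := j ∘ₗ i
  have hk := IsSES.of_injective (i := k) (hjc.inj.comp hs.inj)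
  let L' := Q ⧸ LinearMap.range k
  -- the induced maps `N → L' → M'`
  obtain ⟨a, ha⟩ := exists_comp_eq_of_ses hs ((LinearMap.range k).mkQ ∘ₗ j) (by
    ext x; exact hk.exact.apply_apply_eq_zero x)
  obtain ⟨b, hb⟩ := exists_comp_eq_of_ses hk c (by
    ext x; exact hjc.exact.apply_apply_eq_zero (i x))
  have ha' (m) : a (p m) = (LinearMap.range k).mkQ (j m) := LinearMap.congr_fun ha m
  have hb' (x) : b ((LinearMap.range k).mkQ x) = c x := LinearMap.congr_fun hb x
  refine ⟨.of R L', M', a, b, ⟨?_, ?_, ?_⟩, ⟨?_, ?_, ?_⟩, hM'⟩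
  · rw [injective_iff_map_eq_zero]
    intro x hx
    obtain ⟨m, rfl⟩ := hs.surj x
    rw [ha'] at hx
    obtain ⟨l, hl⟩ := (hk.exact _).1 hx
    rw [← hjc.inj hl]
    exact hs.exact.apply_apply_eq_zero l
  · intro y
    obtain ⟨x, rfl⟩ := hk.surj y
    rw [hb', hjc.exact x]
    constructor
    · rintro ⟨m, rfl⟩
      exact ⟨p m, ha' m⟩
    · rintro ⟨n, hn⟩
      obtain ⟨m, rfl⟩ := hs.surj n
      rw [ha', ← sub_eq_zero, ← map_sub, hk.exact] at hn
      obtain ⟨l, hl⟩ := hn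
      exact ⟨m - i l, by rw [map_sub, show j (i l) = k l from rfl, hl]; abel⟩
  · intro y
    obtain ⟨x, rfl⟩ := hjc.surj y
    exact ⟨_, hb' x⟩
  · exact Module.Finite.of_surjective _ hk.surj
  · obtain ⟨_, _⟩ := exists_module_tower S R L
    obtain ⟨_, _⟩ := exists_module_tower S R M
    obtain ⟨_, _⟩ := exists_module_tower S R N
    obtain ⟨_, _⟩ := exists_module_tower S R Q
    obtain ⟨_, _⟩ := exists_module_tower S R M'
    have := flatOver_iff.1 hN
    have := flatOver_iff.1 hM'.flat
    have : Module.Flat S Q := flatOver_iff.1 (.of_projective (R := R))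
    -- L → Q is a composite of universally injective maps, since N and M' are flat; this gives
    -- flatness of Q/L.
    have hp : IsPureInjective (k.restrictScalars S) := fun T _ _ => by
      have h1 := (hjc.isPureInjective S T).comp (hs.isPureInjective S T)
      rw [← LinearMap.coe_comp, ← LinearMap.lTensor_comp] at h1
      exact h1
    exact flatOver_iff.2 (hp.flat_of_exact (g := (LinearMap.range k).mkQ.restrictScalars S)
      hk.exact hk.surj)
  · exact .X₃ hk hL.pd .of_projective

/-- The sequence (a) obtained from a sequence (b) for a first syzygy. -/
lemma HasSeqB.hasSeqA [IsNoetherianRing R] {P : Type u} [AddCommGroup P] [Module R P]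
    [Module.Finite R P] [Module.Projective R P] {i : N' →ₗ[R] P} {p : P →ₗ[R] N} (hs : IsSES i p)
    (hr : 1 < r) (h : HasSeqB S R r d N') : HasSeqA S R r d N := by
  obtain ⟨L, M, j, q, hjq, hL, hM⟩ := h
  -- The pushout of P and L along the syzygy N' is an extension of M by P. It splits because Ext¹(M,
  -- P) = 0, which needs `1 < r`; ψ is the splitting written on L, and P × M is the pushout.
  obtain ⟨ψ, hψ⟩ := (hM.extZero (InP.of_projective (n := 0) (N := P)) hr).exists_extend hjq i
  have hψ' (x) : ψ (j x) = i x := LinearMap.congr_fun hψ x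
  obtain ⟨θ, hθ⟩ := exists_comp_eq_of_ses hjq (p ∘ₗ ψ) (by
    ext x
    simp [hψ', hs.exact.apply_apply_eq_zero])
  have hθ' (x) : θ (q x) = p (ψ x) := LinearMap.congr_fun hθ x
  refine ⟨L, .of R (P × M), ψ.prod q, p ∘ₗ LinearMap.fst R P M - θ ∘ₗ LinearMap.snd R P M,
    ⟨?_, ?_, ?_⟩, hL, .prod .of_projective hM⟩
  · rw [injective_iff_map_eq_zero]
    intro x hx
    have h1 : ψ x = 0 := congrArg Prod.fst hx
    have h2 : q x = 0 := congrArg Prod.snd hx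
    obtain ⟨y, rfl⟩ := (hjq.exact x).1 h2
    rw [hψ', ← map_zero i] at h1
    rw [hs.inj h1, map_zero]
  · rintro ⟨x, m⟩
    obtain ⟨l, rfl⟩ := hjq.surj m
    have h0 : (p ∘ₗ LinearMap.fst R P M - θ ∘ₗ LinearMap.snd R P M) (x, q l) = p (x - ψ l) := by
      simp [hθ']
    rw [h0, hs.exact]
    constructor
    · rintro ⟨y, hy⟩
      refine ⟨l + j y, Prod.ext ?_ ?_⟩
      · change ψ (l + j y) = x
        rw [map_add, hψ', hy, add_sub_cancel]
      · change q (l + j y) = q l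
        rw [map_add, hjq.exact.apply_apply_eq_zero, add_zero]
    · rintro ⟨l', hl'⟩
      have h1 : ψ l' = x := congrArg Prod.fst hl'
      have h2 : q l' = q l := congrArg Prod.snd hl'
      rw [← sub_eq_zero, ← map_sub, hjq.exact] at h2
      obtain ⟨y, hy⟩ := h2
      exact ⟨y, by rw [← hψ', hy, map_sub, h1]⟩
  · intro n
    obtain ⟨x, rfl⟩ := hs.surj n
    exact ⟨(x, 0), by simp⟩

/-- Replacing N by its first syzygy trades one unit of `n` for one unit of `r`, leaving `r + n`
fixed. The sequence (b) of the syzygy gives (a) for N at level `r`, which in turn gives (b) at level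
`r - 1`. For `n = 0` the truncated `n - 1` is harmless, as L = 0 there. -/
theorem hasSeq_of_isSyzygy [IsNoetherianRing R] (n : ℕ) : ∀ (r : ℕ), 1 < r →
    ∀ (N Z : ModuleCat.{u} R), FlatOver S R N → IsSyzygy n N Z → InX S R (r + n) Z →
      HasSeqA S R r (n - 1) N ∧ HasSeqB S R (r - 1) n N := by
  induction n with
  | zero =>
    rintro r hr N Z hN ⟨e⟩ hZ
    have hX : InX S R r N := hZ.congr e.toLinearEquiv
    obtain ⟨r, rfl⟩ := Nat.exists_eq_add_of_lt hr
    exact ⟨hX.hasSeqA, InX.hasSeqB (by lia) (hX.mono (by lia))⟩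
  | succ n ih =>
    rintro r hr N Z hN ⟨P, p, _, _, hp, hZ⟩ hX
    have hs := IsSES.of_surjective (p := p.hom) hp
    obtain ⟨-, hB⟩ := ih (r + 1) (by lia) (.of R (LinearMap.ker p.hom)) Z
      (FlatOver.left hs .of_projective hN) hZ (hX.mono (by lia))
    have hA : HasSeqA S R r n N := HasSeqB.hasSeqA hs hr hB
    refine ⟨hA, ?_⟩
    obtain ⟨r, rfl⟩ := Nat.exists_eq_add_of_lt hr
    exact HasSeqA.hasSeqB (by lia) hN (by simpa using hA)

lemma hasSeqA_pi (k : ℕ) : ∀ (N : Fin k → ModuleCat.{u} R), (∀ i, HasSeqA S R r d (N i)) →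
    HasSeqA S R r d (∀ i, N i) := by
  induction k with
  | zero => exact fun N _ => InX.hasSeqA .of_projective
  | succ k ih =>
    exact fun N h => ((h 0).prod (ih _ fun i => h i.succ)).congr
        (Fin.consLinearEquiv R fun i => N i)

lemma hasSeqB_pi [IsNoetherianRing R] (hr : 0 < r) (k : ℕ) : ∀ (N : Fin k → ModuleCat.{u} R),
    (∀ i, HasSeqB S R r d (N i)) → HasSeqB S R r d (∀ i, N i) := by
  induction k with
  | zero => exact fun N _ => InX.hasSeqB hr .of_projective
  | succ k ih =>
    exact fun N h => ((h 0).prod (ih _ fun i => h i.succ)).congr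
        (Fin.consLinearEquiv R fun i => N i)

lemma finite_of_isSyzygy [IsNoetherianRing R] (n : ℕ) : ∀ (N Z : ModuleCat.{u} R),
    Module.Finite R N → IsSyzygy n N Z → Module.Finite R Z := by
  induction n with
  | zero =>
    rintro N Z _ ⟨e⟩
    exact Module.Finite.equiv e.toLinearEquiv.symm
  | succ n ih =>
    rintro N Z _ ⟨P, p, _, _, hp, hZ⟩
    exact ih _ Z (inferInstanceAs (Module.Finite R (LinearMap.ker p.hom))) hZ

/-- A direct sum of modules with stably reflexive syzygies. -/
def InY (S R : Type u) [CommRing S] [CommRing R] [Algebra S R] (r s : ℕ)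
    (N : Type u) [AddCommGroup N] [Module R N] : Prop :=
  Module.Finite R N ∧ FlatOver S R N ∧ ∃ (k : ℕ) (Ni : Fin k → ModuleCat.{u} R),
    Nonempty (N ≃ₗ[R] ∀ i, Ni i) ∧ ∀ i, ∃ n < s, ∃ Z : ModuleCat.{u} R,
      IsSyzygy n (Ni i) Z ∧ InX S R (r + n) Z

theorem InY.hasSeq [IsNoetherianRing R] {s : ℕ} (hr : 1 < r) (h : InY S R r s N) :
    HasSeqA S R r (s - 2) N ∧ HasSeqB S R (r - 1) (s - 1) N := by
  obtain ⟨_, hfl, k, Ni, ⟨e⟩, h⟩ := h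
  have key (i) : HasSeqA S R r (s - 2) (Ni i) ∧ HasSeqB S R (r - 1) (s - 1) (Ni i) := by
    obtain ⟨n, hn, Z, hZ, hX⟩ := h i
    have hi : FlatOver S R (Ni i) := hfl.of_retract
      (e.symm.toLinearMap ∘ₗ LinearMap.single R (fun i => Ni i) i)
      (LinearMap.proj i ∘ₗ e.toLinearMap) (by ext; simp)
    obtain ⟨hA, hB⟩ := hasSeq_of_isSyzygy n r hr (Ni i) Z hi hZ hX
    exact ⟨hA.mono (by lia), hB.mono (by lia)⟩
  exact ⟨(hasSeqA_pi k Ni fun i => (key i).1).congr e.symm,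
    (hasSeqB_pi (by lia) k Ni fun i => (key i).2).congr e.symm⟩

end Sequences

/-! ### Base change of syzygies, and the inclusions into Y -/

section BaseChangeY

variable {R : Type u} [CommRing R]

lemma IsSyzygy.congr (n : ℕ) : ∀ {N N' Z : ModuleCat.{u} R}, IsSyzygy n N Z →
    (N ≃ₗ[R] N') → IsSyzygy n N' Z := by
  induction n with
  | zero =>
    rintro N N' Z ⟨e⟩ f
    exact ⟨e ≪≫ f.toModuleIso⟩
  | succ n ih =>
    rintro N N' Z ⟨P, p, h1, h2, hp, hZ⟩ f
    refine ⟨P, ModuleCat.ofHom (f.toLinearMap ∘ₗ p.hom), h1, h2, f.surjective.comp hp, ih hZ ?_⟩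
    exact LinearEquiv.ofEq _ _ (by simp [LinearMap.ker_comp])

variable {S : Type u} [CommRing S] [Algebra S R]

lemma InX.inY {r s : ℕ} (hs : 0 < s) {N : Type u} [AddCommGroup N] [Module R N]
    (h : InX S R r N) : InY S R r s N :=
  ⟨h.finite, h.flat, 1, fun _ => .of R N, ⟨(LinearEquiv.funUnique (Fin 1) R N).symm⟩,
    fun _ => ⟨0, hs, .of R N, ⟨Iso.refl _⟩, h⟩⟩

variable [Module.Flat S R]

lemma IsSyzygy.baseChange (S' R' : Type u) [CommRing S'] [CommRing R']
    [Algebra S S'] [Algebra R R'] [Algebra S' R'] [Algebra S R'] [IsScalarTower S R R']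
    [IsScalarTower S S' R'] [Algebra.IsPushout S S' R R'] (n : ℕ) : ∀ {N Z : ModuleCat.{u} R},
    FlatOver S R N → IsSyzygy n N Z →
      IsSyzygy n (ModuleCat.of R' (R' ⊗[R] N)) (ModuleCat.of R' (R' ⊗[R] Z)) := by
  induction n with
  | zero =>
    rintro N Z _ ⟨e⟩
    exact ⟨(e.toLinearEquiv.baseChange R R' Z N).toModuleIso⟩
  | succ n ih =>
    rintro N Z hN ⟨P, p, _, _, hp, hZ⟩
    have hs := IsSES.of_surjective (p := p.hom) hp
    have hs' := hs.baseChange_of_flatOver hN S' R'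
    refine ⟨.of R' (R' ⊗[R] P), ModuleCat.ofHom (p.hom.baseChange R'),
      inferInstanceAs (Module.Finite R' (R' ⊗[R] P)),
      inferInstanceAs (Module.Projective R' (R' ⊗[R] P)), hs'.surj,
      (ih (.left hs .of_projective hN) hZ).congr n ?_⟩
    exact (LinearEquiv.ofInjective _ hs'.inj).trans
      (LinearEquiv.ofEq _ _ (LinearMap.exact_iff.1 hs'.exact).symm)

lemma InY.baseChange {r s : ℕ} {N : Type u} [AddCommGroup N] [Module R N] (h : InY S R r s N)
    (S' R' : Type u) [CommRing S'] [CommRing R']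
    [Algebra S S'] [Algebra R R'] [Algebra S' R'] [Algebra S R'] [IsScalarTower S R R']
    [IsScalarTower S S' R'] [Algebra.IsPushout S S' R R'] : InY S' R' r s (R' ⊗[R] N) := by
  obtain ⟨_, hfl, k, Ni, ⟨e⟩, h⟩ := h
  refine ⟨inferInstance, hfl.baseChange S' R', k, fun i => .of R' (R' ⊗[R] Ni i),
    ⟨(e.baseChange R R' N _).trans (TensorProduct.piRight R R' R' fun i => Ni i)⟩, fun i => ?_⟩
  obtain ⟨n, hn, Z, hZ, hX⟩ := h i
  have hi : FlatOver S R (Ni i) := hfl.of_retract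
    (e.symm.toLinearMap ∘ₗ LinearMap.single R (fun i => Ni i) i)
    (LinearMap.proj i ∘ₗ e.toLinearMap) (by ext; simp)
  exact ⟨n, hn, .of R' (R' ⊗[R] Z), hZ.baseChange S' R' n hi, hX.baseChange S' R'⟩

lemma exists_isSyzygy_projective [IsNoetherianRing R] (n : ℕ) : ∀ N : ModuleCat.{u} R,
    Module.Finite R N → PdLE R N n →
      ∃ Z : ModuleCat.{u} R, IsSyzygy n N Z ∧ Module.Finite R Z ∧ Module.Projective R Z := by
  induction n with
  | zero => exact fun N hN h => ⟨N, ⟨Iso.refl _⟩, hN, pdLE_zero_iff.1 h⟩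
  | succ n ih =>
    intro N _ h
    obtain ⟨k, p, hp⟩ := Module.Finite.exists_fin' R N
    obtain ⟨Z, hZ, h1, h2⟩ := ih (.of R (LinearMap.ker p))
      (inferInstanceAs (Module.Finite R (LinearMap.ker p)))
      (PdLE.X₁ (IsSES.of_surjective hp) .of_projective h)
    exact ⟨Z, ⟨.of R (Fin k → R), ModuleCat.ofHom p, inferInstanceAs (Module.Finite R (Fin k → R)),
      inferInstanceAs (Module.Projective R (Fin k → R)), hp, hZ⟩, h1, h2⟩

/-- The `d`-th syzygy of a module of projective dimension at most `d` is projective, hence stably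
reflexive of every level. -/
lemma InP.inY [IsNoetherianRing R] {r d s : ℕ} (hs : d < s) {N : Type u} [AddCommGroup N]
    [Module R N] (h : InP S R d N) : InY S R r s N := by
  obtain ⟨Z, hZ, _, _⟩ := exists_isSyzygy_projective d (.of R N) h.finite h.pd
  exact ⟨h.finite, h.flat, 1, fun _ => .of R N, ⟨(LinearEquiv.funUnique (Fin 1) R N).symm⟩,
    fun _ => ⟨d, hs, Z, hZ, .of_projective⟩⟩

end BaseChangeY

/-! ### Translation between the fibrewise and the universal definitions -/

section Comparison

variable {S R : Type u} [CommRing S] [CommRing R] (h : S →+* R) (N : ModuleCat.{u} R) {n r s : ℕ}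

/-- Extension of scalars along a structure map is the tensor product. -/
lemma nonempty_extendScalars_equiv {R R' : Type u} [CommRing R] [CommRing R'] [i : Algebra R R']
    (f : R →+* R') (hf : algebraMap R R' = f) (N : ModuleCat.{u} R) :
    Nonempty ((ModuleCat.extendScalars f).obj N ≃ₗ[R'] R' ⊗[R] N) := by
  obtain rfl : i = f.toAlgebra := Algebra.algebra_ext _ _ fun x => congr($hf x)
  let _ := f.toAlgebra
  exact ⟨LinearEquiv.refl R' (R' ⊗[R] N)⟩

lemma sr_iff_isStablyReflexive {A M : Type u} [CommRing A] [AddCommGroup M] [Module A M]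
    {N : ModuleCat.{u} A} (e : N ≃ₗ[A] M) : IsStablyReflexive n N ↔ SR A n M :=
  ⟨fun H => SR.congr (M := N) H e, fun H => H.congr e.symm⟩

lemma isStablyReflexiveOver_iff : letI := h.toAlgebra
    IsStablyReflexiveOver n h N ↔ FlatOver S R N ∧ FibreSR S R n N := by
  let _ := h.toAlgebra
  refine and_congr_right fun _ => ⟨fun H m hm p _ hp => ?_, ?_⟩
  · obtain ⟨e⟩ := nonempty_extendScalars_equiv
      (Algebra.TensorProduct.includeLeftRingHom : R →+* R ⊗[S] p.ResidueField) rfl N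
    refine (sr_iff_isStablyReflexive e).1 (H ⟨p, inferInstance⟩ ⟨⟨m, hm⟩, ?_⟩)
    exact PrimeSpectrum.ext hp.symm
  · rintro H _ ⟨m, rfl⟩
    obtain ⟨e⟩ := nonempty_extendScalars_equiv (Algebra.TensorProduct.includeLeftRingHom :
      R →+* R ⊗[S] (m.asIdeal.comap (algebraMap S R)).ResidueField) rfl N
    exact (sr_iff_isStablyReflexive e).2 (H m.asIdeal m.isMaximal _ rfl)

variable {h N}

lemma catP_iff : letI := h.toAlgebra
    catP n h N ↔ InP S R n N :=
  let _ := h.toAlgebra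
  ⟨fun H => ⟨H.1.1, H.1.2, H.2⟩, fun H => ⟨⟨H.1, H.2⟩, H.3⟩⟩

lemma catX_of_inX : letI := h.toAlgebra; InX S R n N → catX n h N := by
  let _ := h.toAlgebra
  exact fun H => ⟨⟨H.1, H.2⟩, (isStablyReflexiveOver_iff h N).2 ⟨H.2, H.3.fibreSR⟩⟩

variable [IsNoetherianRing R]

/-- The bound `1 < n` is essential to the method: at level one no Ext vanishing on the fibres is
available to start from. -/
lemma inX_of_isStablyReflexiveOver (hh : h.Flat) (hn : 1 < n) (hN : Module.Finite R N)
    (H : IsStablyReflexiveOver n h N) : letI := h.toAlgebra; InX S R n N := by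
  let _ := h.toAlgebra
  have : Module.Flat S R := hh
  obtain ⟨h1, h2⟩ := (isStablyReflexiveOver_iff h N).1 H
  obtain ⟨_, _⟩ := exists_module_tower S R N
  have := flatOver_iff.1 h1
  exact ⟨hN, h1, h2.univSR hn⟩

lemma catX_iff (hh : h.Flat) (hn : 1 < n) : letI := h.toAlgebra; catX n h N ↔ InX S R n N :=
  ⟨fun H => inX_of_isStablyReflexiveOver hh hn H.1.1 H.2, catX_of_inX⟩

lemma catY_iff (hh : h.Flat) (hr : 1 < r) : letI := h.toAlgebra; catY r s h N ↔ InY S R r s N := by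
  let _ := h.toAlgebra
  constructor
  · rintro ⟨⟨hfin, hfl⟩, k, Ni, ⟨e⟩, H⟩
    let e' := e.trans (DirectSum.linearEquivFunOnFintype R (Fin k) fun i => Ni i)
    refine ⟨hfin, hfl, k, Ni, ⟨e'⟩, fun i => ?_⟩
    obtain ⟨n, hn, Z, hZ, hX⟩ := H i
    have : Module.Finite R (Ni i) := Module.Finite.of_surjective
      ((LinearMap.proj i : (∀ i, Ni i) →ₗ[R] Ni i) ∘ₗ e'.toLinearMap)
      ((LinearMap.proj_surjective (R := R) (φ := fun i => Ni i) i).comp e'.surjective)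
    exact ⟨n, hn, Z, hZ, inX_of_isStablyReflexiveOver hh (by lia)
      (finite_of_isSyzygy n _ Z this hZ) hX⟩
  · rintro ⟨hfin, hfl, k, Ni, ⟨e⟩, H⟩
    refine ⟨⟨hfin, hfl⟩, k, Ni,
      ⟨e.trans (DirectSum.linearEquivFunOnFintype R (Fin k) fun i => Ni i).symm⟩, fun i => ?_⟩
    obtain ⟨n, hn, Z, hZ, hX⟩ := H i
    exact ⟨n, hn, Z, hZ, (catX_of_inX hX).2⟩

end Comparison

section AlgFl

variable {h h₂ : AlgFl.{u}}

lemma AlgFl.flat (h : AlgFl.{u}) : h.h.hom.Flat := h.faithfullyFlat.flat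

/-- The pushout square of algebras underlying an arrow of `Alg^fl`. -/
lemma AlgFl.Hom.exists_isPushout (a : AlgFl.Hom h h₂) :
    letI := h.h.hom.toAlgebra
    letI := h₂.h.hom.toAlgebra
    letI := a.g.hom.toAlgebra
    letI := a.f.hom.toAlgebra
    letI := (h₂.h.hom.comp a.g.hom).toAlgebra
    IsScalarTower h.S h.R h₂.R ∧ IsScalarTower h.S h₂.S h₂.R ∧
      ∀ [IsScalarTower h.S h.R h₂.R] [IsScalarTower h.S h₂.S h₂.R],
        Algebra.IsPushout h.S h₂.S h.R h₂.R := by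
  let _ := h.h.hom.toAlgebra
  let _ := h₂.h.hom.toAlgebra
  let _ := a.g.hom.toAlgebra
  let _ := a.f.hom.toAlgebra
  let _ := (h₂.h.hom.comp a.g.hom).toAlgebra
  have h1 : IsScalarTower h.S h.R h₂.R := .of_algebraMap_eq fun x =>
    (congr($(a.isPushout.w) x) : a.f (h.h x) = h₂.h (a.g x)).symm
  have h2 : IsScalarTower h.S h₂.S h₂.R := .of_algebraMap_eq fun _ => rfl
  exact ⟨h1, h2, CommRingCat.isPushout_iff_isPushout.1 a.isPushout.flip⟩

end AlgFl

/-! ### Factorization, and stability of the sequences under base change -/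

section Lifting

lemma ExtZero.exists_lift {A K P N X : Type u} [CommRing A] [AddCommGroup K] [AddCommGroup P]
    [AddCommGroup N] [AddCommGroup X] [Module A K] [Module A P] [Module A N] [Module A X]
    {i : K →ₗ[A] P} {p : P →ₗ[A] N} (h : IsSES i p) (hX : ExtZero A X K 1) (φ : X →ₗ[A] N) :
    ∃ ψ : X →ₗ[A] P, p ∘ₗ ψ = φ := by
  obtain ⟨y, hy⟩ := Abelian.Ext.covariant_sequence_exact₃ (ModuleCat.of A X) h.shortExact
    (Abelian.Ext.mk₀ (ModuleCat.ofHom φ)) (zero_add 1) (hX.eq_zero _)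
  obtain ⟨ψ, rfl⟩ := (Abelian.Ext.mk₀_bijective _ _).2 y
  rw [Abelian.Ext.mk₀_comp_mk₀] at hy
  exact ⟨ψ.hom, congrArg ModuleCat.Hom.hom ((Abelian.Ext.mk₀_bijective _ _).1 hy)⟩

variable {S R : Type u} [CommRing S] [CommRing R] [Algebra S R] [IsNoetherianRing R]
  {L M N X : Type u} [AddCommGroup L] [AddCommGroup M] [AddCommGroup N] [AddCommGroup X]
  [Module R L] [Module R M] [Module R N] [Module R X] {r d : ℕ}

lemma InX.exists_lift {i : L →ₗ[R] M} {p : M →ₗ[R] N} (h : IsSES i p) (hX : InX S R r X)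
    (hL : InP S R d L) (hd : d + 1 < r) (φ : X →ₗ[R] N) : ∃ ψ : X →ₗ[R] M, p ∘ₗ ψ = φ :=
  (hX.extZero hL hd).exists_lift h φ

lemma InX.exists_extend {j : N →ₗ[R] L} {q : L →ₗ[R] M} (h : IsSES j q) (hM : InX S R r M)
    (hX : InP S R d X) (hd : d + 1 < r) (φ : N →ₗ[R] X) : ∃ ψ : L →ₗ[R] X, ψ ∘ₗ j = φ :=
  (hM.extZero hX hd).exists_extend h φ

end Lifting

section StableSequences

variable {h : AlgFl.{u}} {r s : ℕ}

lemma isStableSeqA_of {T : ShortComplex (ModuleCat.{u} h.R)} (hr : 1 < r)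
    (hT : IsSeqA r s h.h.hom T) (hY : catY r s h.h.hom T.X₃) : IsStableSeqA r s h T := by
  have := h.noeth_R
  refine ⟨⟨hT, hY⟩, fun h₂ a => ?_⟩
  have := h₂.noeth_R
  let _ := h.h.hom.toAlgebra
  let _ := h₂.h.hom.toAlgebra
  let _ := (AlgFl.Hom.g a).hom.toAlgebra
  let _ := (AlgFl.Hom.f a).hom.toAlgebra
  let _ := (h₂.h.hom.comp (AlgFl.Hom.g a).hom).toAlgebra
  obtain ⟨_, _, hp⟩ := AlgFl.Hom.exists_isPushout a
  have := hp
  have : Module.Flat h.S h.R := h.flat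
  obtain ⟨hs, hL, hM⟩ := hT
  have hs' : IsSES T.f.hom T.g.hom := (shortExact_mk_iff T.f T.g T.zero).1 hs
  rw [catY_iff h.flat hr] at hY
  rw [catP_iff] at hL
  rw [catX_iff h.flat hr] at hM
  refine ⟨⟨?_, catP_iff.2 (hL.baseChange h₂.S h₂.R), catX_of_inX (hM.baseChange h₂.S h₂.R)⟩,
    (catY_iff h₂.flat hr).2 (hY.baseChange h₂.S h₂.R)⟩
  exact (shortExact_mk_iff _ _ _).2 (hs'.baseChange_of_flatOver hY.2.1 h₂.S h₂.R)

/-- The third term is assumed universally stably reflexive because `r - 1` may equal 1, where the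
passage from fibres to base changes does not apply. The constructed sequences have this property
anyway. -/
lemma isStableSeqB_of {T : ShortComplex (ModuleCat.{u} h.R)} (hr : 1 < r)
    (hs : T.ShortExact) (hL : catP (s - 1) h.h.hom T.X₂)
    (hM : letI := h.h.hom.toAlgebra; InX h.S h.R (r - 1) T.X₃)
    (hY : catY r s h.h.hom T.X₁) : IsStableSeqB r s h T := by
  have := h.noeth_R
  refine ⟨⟨⟨hs, hL, catX_of_inX hM⟩, hY⟩, fun h₂ a => ?_⟩
  have := h₂.noeth_R
  let _ := h.h.hom.toAlgebra
  let _ := h₂.h.hom.toAlgebra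
  let _ := (AlgFl.Hom.g a).hom.toAlgebra
  let _ := (AlgFl.Hom.f a).hom.toAlgebra
  let _ := (h₂.h.hom.comp (AlgFl.Hom.g a).hom).toAlgebra
  obtain ⟨_, _, hp⟩ := AlgFl.Hom.exists_isPushout a
  have := hp
  have : Module.Flat h.S h.R := h.flat
  have hs' : IsSES T.f.hom T.g.hom := (shortExact_mk_iff T.f T.g T.zero).1 hs
  rw [catY_iff h.flat hr] at hY
  rw [catP_iff] at hL
  refine ⟨⟨?_, catP_iff.2 (hL.baseChange h₂.S h₂.R), catX_of_inX (hM.baseChange h₂.S h₂.R)⟩,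
    (catY_iff h₂.flat hr).2 (hY.baseChange h₂.S h₂.R)⟩
  exact (shortExact_mk_iff _ _ _).2 (hs'.baseChange_of_flatOver hM.2 h₂.S h₂.R)

end StableSequences

/-! ### Approximations in the total category -/

section Approximations

variable {h : AlgFl.{u}} {r s : ℕ}

/-- An arrow of `mod^fl` factors through the base change of its source. -/
lemma ModFl.Hom.exists_linearMap {N₁ N₂ : ModFl.{u}} (φ : ModFl.Hom N₁ N₂) :
    letI := φ.base.f.hom.toAlgebra
    ∃ φ' : N₂.alg.R ⊗[N₁.alg.R] N₁.mod →ₗ[N₂.alg.R] N₂.mod, ∀ x, φ' (1 ⊗ₜ x) = φ.map x := by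
  let _ := φ.base.f.hom.toAlgebra
  let _ : Module N₁.alg.R N₂.mod := Module.compHom _ φ.base.f.hom
  have : IsScalarTower N₁.alg.R N₂.alg.R N₂.mod :=
    ⟨fun a b x => by rw [Algebra.smul_def, mul_smul]; rfl⟩
  let l : N₁.mod →ₗ[N₁.alg.R] N₂.mod := { φ.map with map_smul' := φ.map_smul }
  exact ⟨l.liftBaseChange N₂.alg.R, fun x => by simp [l]⟩

/-- The arrow of `mod^fl` given by a linear map on the base change of its source. -/
def ModFl.homOfLinearMap {N₁ N₂ : ModFl.{u}} (a : AlgFl.Hom N₁.alg N₂.alg)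
    (φ : letI := a.f.hom.toAlgebra
      N₂.alg.R ⊗[N₁.alg.R] N₁.mod →ₗ[N₂.alg.R] N₂.mod) : ModFl.Hom N₁ N₂ :=
  letI := a.f.hom.toAlgebra
  { base := a
    map := φ.toAddMonoidHom.comp (TensorProduct.mk N₁.alg.R N₂.alg.R N₁.mod 1).toAddMonoidHom
    map_smul := fun x m => by
      change φ (1 ⊗ₜ (x • m)) = a.f.hom x • φ (1 ⊗ₜ m)
      rw [← map_smul, TensorProduct.tmul_smul, TensorProduct.smul_tmul', TensorProduct.smul_tmul']
      rfl }

/-- An arrow from M' over a nontrivial base is a linear map from the base change of M', which is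
again in X(r). The obstruction to lifting it lies in Ext¹ into L, and it vanishes since `(s - 2) + 1
< r`. -/
theorem isRightApprox_of_isSeqA (hr : 1 < r) (hsr : s ≤ r)
    {L M N : ModuleCat.{u} h.R} (hN : modFlat h.h.hom N) (hM : modFlat h.h.hom M)
    {i : L ⟶ M} {p : M ⟶ N} {w : i ≫ p = 0} (hT : IsSeqA r s h.h.hom (ShortComplex.mk i p w)) :
    IsRightApprox (totX r) (ModFl.ofHom hM hN p) := by
  refine ⟨hT.2.2, fun M' φ hM' => ?_⟩
  let a : AlgFl.Hom M'.alg h := ModFl.Hom.base φ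
  have := h.noeth_R
  have := M'.alg.noeth_R
  let _ := h.h.hom.toAlgebra
  let _ := M'.alg.h.hom.toAlgebra
  let _ := a.g.hom.toAlgebra
  let _ := a.f.hom.toAlgebra
  let _ := (h.h.hom.comp a.g.hom).toAlgebra
  obtain ⟨_, _, hp⟩ := a.exists_isPushout
  have := hp
  obtain ⟨hse, hL, -⟩ := hT
  rw [shortExact_mk_iff] at hse
  have hL' := catP_iff.1 hL
  have hX := ((catX_iff M'.alg.flat hr).1 hM').baseChange h.S h.R
  obtain ⟨φ', hφ'⟩ := ModFl.Hom.exists_linearMap φ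
  obtain ⟨ψ, hψ⟩ := hX.exists_lift hse hL' (by lia) φ'
  refine ⟨ModFl.homOfLinearMap a ψ, ModFl.Hom.ext (Category.comp_id (X := M'.alg) (Y := h) a) ?_⟩
  ext x
  exact (LinearMap.congr_fun hψ (1 ⊗ₜ x)).trans (hφ' x)

/-- Here the whole sequence is base changed to the ring of the target, exactness surviving because M
is flat. Extension is obstructed by Ext¹ of the base change of M, at level `r - 1`, into a module of
projective dimension at most `d`; hence `d + 1 < r - 1`. -/
theorem isLeftApprox_of_isSeqB {d : ℕ} (hr : 1 < r - 1) (hd : d + 2 < r)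
    {N L M : ModuleCat.{u} h.R} (hN : modFlat h.h.hom N) (hL : modFlat h.h.hom L)
    {j : N ⟶ L} {q : L ⟶ M} (hse : IsSES j.hom q.hom) (hPL : catP d h.h.hom L)
    (hM : catX (r - 1) h.h.hom M) :
    IsLeftApprox (totP d) (ModFl.ofHom hN hL j) := by
  refine ⟨hPL, fun L' φ hL' => ?_⟩
  let a : AlgFl.Hom h L'.alg := ModFl.Hom.base φ
  have := h.noeth_R
  have := L'.alg.noeth_R
  let _ := h.h.hom.toAlgebra
  let _ := L'.alg.h.hom.toAlgebra
  let _ := a.g.hom.toAlgebra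
  let _ := a.f.hom.toAlgebra
  let _ := (L'.alg.h.hom.comp a.g.hom).toAlgebra
  obtain ⟨_, _, hp⟩ := a.exists_isPushout
  have := hp
  have hM' := (catX_iff h.flat hr).1 hM
  have hse' := hse.baseChange_of_flatOver hM'.flat L'.alg.S L'.alg.R
  obtain ⟨φ', hφ'⟩ := ModFl.Hom.exists_linearMap φ
  obtain ⟨ψ, hψ⟩ := (hM'.baseChange L'.alg.S L'.alg.R).exists_extend hse' (catP_iff.1 hL')
      (by lia) φ'
  refine ⟨ModFl.homOfLinearMap a ψ, ModFl.Hom.ext (Category.id_comp (X := h) (Y := L'.alg) a) ?_⟩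
  ext x
  exact (LinearMap.congr_fun hψ (1 ⊗ₜ x)).trans (hφ' x)

end Approximations

/-! ### Nakayama's lemma and splitting off free summands -/

section Nakayama

variable {R : Type u} [CommRing R]

/-- Over a local ring, `1 + ab` is surjective if `ba` is an endomorphism of a finite projective
module all of whose coordinates lie in the maximal ideal. -/
lemma surjective_add_of_mem_maximalIdeal [IsLocalRing R] {M Q : Type u} [AddCommGroup M]
    [AddCommGroup Q]
    [Module R M] [Module R Q] [Module.Finite R Q] [Module.Projective R Q] (a : Q →ₗ[R] M)
    (b : M →ₗ[R] Q)
    (h : ∀ (f : Q →ₗ[R] R) (z : Q), f (b (a z)) ∈ IsLocalRing.maximalIdeal R) :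
    Function.Surjective (LinearMap.id + a ∘ₗ b : M →ₗ[R] M) := by
  -- Membership in mQ is tested on the coordinates of Q as a direct summand of a free module. Then 1
  -- + ba is surjective by Nakayama, and this passes to 1 + ab even though M need not be finite.
  have hg : ∀ z, b (a z) ∈ IsLocalRing.maximalIdeal R • (⊤ : Submodule R Q) := by
    intro z
    obtain ⟨k, f, g, -, -, hfg⟩ := Module.Finite.exists_comp_eq_id_of_projective R Q
    have h1 : b (a z) = f (∑ i, g (b (a z)) i • Pi.single i 1) := by
      rw [← pi_eq_sum_univ']
      exact (LinearMap.congr_fun hfg _).symm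
    rw [h1, map_sum]
    refine Submodule.sum_mem _ fun i _ => ?_
    rw [map_smul]
    exact Submodule.smul_mem_smul (h (LinearMap.proj (φ := fun _ => R) i ∘ₗ g) z) trivial
  have hsurj : LinearMap.range (LinearMap.id + b ∘ₗ a : Q →ₗ[R] Q) = ⊤ := by
    rw [← top_le_iff]
    refine Submodule.le_of_le_smul_of_le_jacobson_bot (I := IsLocalRing.maximalIdeal R)
      Module.Finite.fg_top (IsLocalRing.maximalIdeal_le_jacobson _) fun z _ => ?_
    have h1 : z = (LinearMap.id + b ∘ₗ a : Q →ₗ[R] Q) z - b (a z) := by simp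
    rw [h1]
    exact sub_mem (Submodule.mem_sup_left ⟨z, rfl⟩) (Submodule.mem_sup_right (hg z))
  intro y
  obtain ⟨z, hz⟩ := LinearMap.range_eq_top.1 hsurj (b y)
  refine ⟨y - a z, ?_⟩
  have h1 : b (a z) = b y - z := by rw [← hz]; simp
  simp [h1]

/-- A functional with a unit value splits off a free summand of rank one. -/
lemma exists_equiv_ker_prod {M : Type u} [AddCommGroup M] [Module R M] (f : M →ₗ[R] R) (m : M)
    (hm : IsUnit (f m)) : ∃ e : M ≃ₗ[R] LinearMap.ker f × R, ∀ x : LinearMap.ker f,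
      e x = (x, 0) := by
  obtain ⟨u, hu⟩ := hm
  let g : R →ₗ[R] M := LinearMap.toSpanSingleton R M ((↑u⁻¹ : R) • m)
  have hfg (c : R) : f (g c) = c := by simp [g, ← hu]
  let k : M →ₗ[R] LinearMap.ker f := (LinearMap.id - g ∘ₗ f).codRestrict _ fun x => by simp [hfg]
  have hk (x : M) : (k x : M) = x - g (f x) := rfl
  refine ⟨.ofLinearMap (k.prod f) ((LinearMap.ker f).subtype.coprod g) ?_ ?_, fun x => ?_⟩
  · refine LinearMap.ext fun x => Prod.ext (Subtype.ext ?_) ?_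
    · simp [hk, hfg]
    · simp [hfg]
  · ext x
    simp [hk]
  · refine Prod.ext (Subtype.ext ?_) ?_
    · simp [hk]
    · simp

variable {S : Type u} [CommRing S] [Algebra S R] {M : Type u} [AddCommGroup M] [Module R M]

lemma InX.ker {r : ℕ} (h : InX S R r M) (f : M →ₗ[R] R) (m : M) (hm : IsUnit (f m)) :
    InX S R r (LinearMap.ker f) := by
  obtain ⟨e, he⟩ := exists_equiv_ker_prod f m hm
  exact h.of_retract (LinearMap.ker f).subtype (LinearMap.fst R _ R ∘ₗ e.toLinearMap)
    (by ext x; simp [he])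

lemma InP.ker {d : ℕ} (h : InP S R d M) (f : M →ₗ[R] R) (m : M) (hm : IsUnit (f m)) :
    InP S R d (LinearMap.ker f) := by
  obtain ⟨e, he⟩ := exists_equiv_ker_prod f m hm
  exact h.of_retract (LinearMap.ker f).subtype (LinearMap.fst R _ R ∘ₗ e.toLinearMap)
    (by ext x; simp [he])

variable (R M) in
/-- The dimension of the fibre at the closed point. -/
def closedRank [IsLocalRing R] : ℕ :=
  Module.finrank (IsLocalRing.ResidueField R) (IsLocalRing.ResidueField R ⊗[R] M)

lemma closedRank_ker_lt [IsLocalRing R] [Module.Finite R M] (f : M →ₗ[R] R) (m : M) (hm : IsUnit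
    (f m)) :
    closedRank R (LinearMap.ker f) < closedRank R M := by
  obtain ⟨e, he⟩ := exists_equiv_ker_prod f m hm
  have : Module.Finite R (LinearMap.ker f) := Module.Finite.of_surjective
    (LinearMap.fst R _ R ∘ₗ e.toLinearMap) ((LinearMap.fst_surjective (R := R)
        (M := LinearMap.ker f) (M₂ := R)).comp e.surjective)
  let k := IsLocalRing.ResidueField R
  have h1 := ((e.baseChange R k _ _).trans (TensorProduct.prodRight R k k _ R)).finrank_eq
  have h2 : Module.finrank k (k ⊗[R] R) = 1 := by
    rw [(AlgebraTensorModule.rid R k k).finrank_eq, Module.finrank_self]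
  rw [Module.finrank_prod, h2] at h1
  exact (Nat.lt_succ_self _).trans_eq h1.symm

end Nakayama

/-! ### Minimal sequences over a local ring -/

section Minimal

variable {S R : Type u} [CommRing S] [CommRing R] [Algebra S R] {N : Type u} [AddCommGroup N]
    [Module R N] {r d : ℕ}

/-- A functional on M with a unit value on L splits the same copy of R off both L and M without
changing N. The fibre rank of M drops, so this stops. -/
lemma HasSeqA.exists_minimal_aux [IsLocalRing R] (n : ℕ) : ∀ (L M : ModuleCat.{u} R) (i : L →ₗ[R] M)
    (p : M →ₗ[R] N), IsSES i p → InP S R d L → InX S R r M → closedRank R M = n →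
    ∃ (L M : ModuleCat.{u} R) (i : L →ₗ[R] M) (p : M →ₗ[R] N), IsSES i p ∧ InP S R d L ∧
      InX S R r M ∧ ∀ (f : M →ₗ[R] R) (l : L), f (i l) ∈ IsLocalRing.maximalIdeal R := by
  induction n using Nat.strong_induction_on with
  | _ n ih =>
  intro L M i p hs hL hM hn
  by_cases! H : ∀ (f : M →ₗ[R] R) (l : L), f (i l) ∈ IsLocalRing.maximalIdeal R
  · exact ⟨L, M, i, p, hs, hL, hM, H⟩
  obtain ⟨f, l, hfl⟩ := H
  have hu : IsUnit (f (i l)) := by simpa using hfl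
  have := hM.finite
  refine ih _ (hn ▸ closedRank_ker_lt f (i l) hu) (.of R (LinearMap.ker (f ∘ₗ i)))
    (.of R (LinearMap.ker f)) (i.restrict fun x hx => hx) (p ∘ₗ (LinearMap.ker f).subtype) ?_
    (hL.ker (f ∘ₗ i) l hu) (hM.ker f (i l) hu) rfl
  refine ⟨fun x y hxy => Subtype.ext (hs.inj (congrArg Subtype.val hxy)), fun x => ?_, fun y => ?_⟩
  · refine (hs.exact x.1).trans ⟨?_, ?_⟩
    · rintro ⟨y, hy⟩
      exact ⟨⟨y, (congrArg f hy).trans x.2⟩, Subtype.ext hy⟩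
    · rintro ⟨y, rfl⟩
      exact ⟨y.1, rfl⟩
  · obtain ⟨x, rfl⟩ := hs.surj y
    obtain ⟨u, hu⟩ := hu
    -- A lift of y is corrected into ker f by a multiple of `i l`, which p does not see.
    refine ⟨⟨x - (f x * ↑u⁻¹ : R) • i l, ?_⟩, ?_⟩
    · simp [← hu]
    · simp [hs.exact.apply_apply_eq_zero]

/-- A common rank one summand is split off L and M; N is untouched because it lies in ker q, hence
in the kernel of every functional pulled back from M. -/
lemma HasSeqB.exists_minimal_aux [IsLocalRing R] (n : ℕ) : ∀ (L M : ModuleCat.{u} R) (j : N →ₗ[R] L)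
    (q : L →ₗ[R] M), IsSES j q → InP S R d L → InX S R r M → closedRank R M = n →
    ∃ (L M : ModuleCat.{u} R) (j : N →ₗ[R] L) (q : L →ₗ[R] M), IsSES j q ∧ InP S R d L ∧
      InX S R r M ∧ ∀ (f : M →ₗ[R] R) (l : L), f (q l) ∈ IsLocalRing.maximalIdeal R := by
  induction n using Nat.strong_induction_on with
  | _ n ih =>
  intro L M j q hs hL hM hn
  by_cases! H : ∀ (f : M →ₗ[R] R) (l : L), f (q l) ∈ IsLocalRing.maximalIdeal R
  · exact ⟨L, M, j, q, hs, hL, hM, H⟩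
  obtain ⟨f, l, hfl⟩ := H
  have hu : IsUnit (f (q l)) := by simpa using hfl
  have := hM.finite
  refine ih _ (hn ▸ closedRank_ker_lt f (q l) hu) (.of R (LinearMap.ker (f ∘ₗ q)))
    (.of R (LinearMap.ker f))
    (j.codRestrict _ fun x => by simp [hs.exact.apply_apply_eq_zero])
    (q.restrict fun x hx => hx) ?_
    (hL.ker (f ∘ₗ q) l hu) (hM.ker f (q l) hu) rfl
  refine ⟨fun x y hxy => hs.inj (congrArg Subtype.val hxy), fun x => ?_, fun y => ?_⟩
  · refine Subtype.ext_iff.trans ((hs.exact x.1).trans ⟨?_, ?_⟩)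
    · rintro ⟨y, hy⟩
      exact ⟨y, Subtype.ext hy⟩
    · rintro ⟨y, rfl⟩
      exact ⟨y, rfl⟩
  · obtain ⟨x, hx⟩ := hs.surj y.1
    exact ⟨⟨x, (congrArg f hx).trans y.2⟩, Subtype.ext hx⟩

variable [IsNoetherianRing R] [Module.Flat S R]

/-- Maps from a stably reflexive module to a module of small projective dimension factor through
a finite projective module. -/
lemma InX.exists_factor {M L : Type u} [AddCommGroup M] [Module R M] [AddCommGroup L] [Module R L]
    (hr : 1 < r) (hM : InX S R r M) (hL : InP S R d L) (hd : d < r) (θ : M →ₗ[R] L) :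
    ∃ (Q : ModuleCat.{u} R) (b : M →ₗ[R] Q) (a : Q →ₗ[R] L), Module.Finite R Q ∧
      Module.Projective R Q ∧ a ∘ₗ b = θ := by
  obtain ⟨r, rfl⟩ := Nat.exists_eq_succ_of_ne_zero (by lia : r ≠ 0)
  obtain ⟨Q, M', j, c, hs, h1, h2, -, hext⟩ := hM.exists_cosyzygy (by lia)
  have := hL.finite
  -- The obstruction is Ext¹ of the cosyzygy of M into L. The surplus vanishing for cosyzygies makes
  -- `d < r` suffice, rather than `d + 1 < r`.
  obtain ⟨a, ha⟩ := (ExtZero.of_pdLE hext d L hL.pd 1 one_pos (by lia)).exists_extend hs θ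
  exact ⟨Q, j, a, h1, h2, ha⟩

/-- Write η = 1 + iθ with θ : M → L, and factor θ = ab through a finite projective Q. Every
coordinate of b i a is a functional on M evaluated on L, so it lies in the maximal ideal. Thus η is
surjective, hence bijective as M is finite. -/
theorem HasSeqA.exists_minimal [IsLocalRing R] (hr : 1 < r) (hd : d < r) (h : HasSeqA S R r d N) :
    ∃ (L M : ModuleCat.{u} R) (i : L →ₗ[R] M) (p : M →ₗ[R] N), IsSES i p ∧ InP S R d L ∧
      InX S R r M ∧ ∀ η : M →ₗ[R] M, p ∘ₗ η = p → Function.Bijective η := by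
  obtain ⟨L, M, i, p, hs, hL, hM⟩ := h
  obtain ⟨L, M, i, p, hs, hL, hM, H⟩ := HasSeqA.exists_minimal_aux _ L M i p hs hL hM rfl
  refine ⟨L, M, i, p, hs, hL, hM, fun η hη => ?_⟩
  have hrange (x) : (η - LinearMap.id : M →ₗ[R] M) x ∈ LinearMap.range i := by
    refine (hs.exact _).1 ?_
    simpa [sub_eq_zero] using LinearMap.congr_fun hη x
  let θ : M →ₗ[R] L := (LinearEquiv.ofInjective i hs.inj).symm.toLinearMap ∘ₗ
    (η - LinearMap.id).codRestrict _ hrange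
  have hθ : i ∘ₗ θ = η - LinearMap.id := by
    ext x
    exact congrArg Subtype.val
      ((LinearEquiv.ofInjective i hs.inj).apply_symm_apply ⟨_, hrange x⟩)
  obtain ⟨Q, b, a, _, _, hab⟩ := hM.exists_factor hr hL hd θ
  have h1 := surjective_add_of_mem_maximalIdeal (i ∘ₗ a) b fun f z => H (f ∘ₗ b) (a z)
  rw [LinearMap.comp_assoc, hab, hθ, add_sub_cancel] at h1
  have := hM.finite
  exact ⟨OrzechProperty.injective_of_surjective_endomorphism η h1, h1⟩

/-- Dually, θ - 1 kills N, so it is βq with β : M → L, and β = ab factors through a finite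
projective module. The coordinates of b q a lie in the maximal ideal. -/
theorem HasSeqB.exists_minimal [IsLocalRing R] (hr : 1 < r) (hd : d < r) (h : HasSeqB S R r d N) :
    ∃ (L M : ModuleCat.{u} R) (j : N →ₗ[R] L) (q : L →ₗ[R] M), IsSES j q ∧ InP S R d L ∧
      InX S R r M ∧ ∀ θ : L →ₗ[R] L, θ ∘ₗ j = j → Function.Bijective θ := by
  obtain ⟨L, M, j, q, hs, hL, hM⟩ := h
  obtain ⟨L, M, j, q, hs, hL, hM, H⟩ := HasSeqB.exists_minimal_aux _ L M j q hs hL hM rfl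
  refine ⟨L, M, j, q, hs, hL, hM, fun θ hθ => ?_⟩
  obtain ⟨β, hβ⟩ := exists_comp_eq_of_ses hs (θ - LinearMap.id) (by
    rw [LinearMap.sub_comp, hθ, LinearMap.id_comp, sub_self])
  obtain ⟨Q, b, a, _, _, hab⟩ := hM.exists_factor hr hL hd β
  have h1 := surjective_add_of_mem_maximalIdeal a (b ∘ₗ q) fun f z => H (f ∘ₗ b) (a z)
  rw [← LinearMap.comp_assoc, hab, hβ, add_sub_cancel] at h1
  have := hL.finite
  exact ⟨OrzechProperty.injective_of_surjective_endomorphism θ h1, h1⟩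

end Minimal

/-! ### Minimality in the total and in the fibre category -/

section Isomorphisms

variable {h : AlgFl.{u}}

/-- A linear automorphism, as an automorphism in `mod^fl`. -/
lemma ModFl.isIso_of_bijective {M : ModuleCat.{u} h.R} (hM : modFlat h.h.hom M)
    (η : ModFl.mk h M hM ⟶ ModFl.mk h M hM) (f : M →ₗ[h.R] M) (hf : Function.Bijective f)
    (hbase : ModFl.Hom.base η = AlgFl.Hom.id h) (hmap : ∀ x : M, ModFl.Hom.map η x = f x) :
    IsIso η := by
  let e := LinearEquiv.ofBijective f hf
  have hη : η = ModFl.ofHom hM hM (ModuleCat.ofHom f) :=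
    ModFl.Hom.ext hbase (AddMonoidHom.ext hmap)
  refine ⟨ModFl.ofHom hM hM (ModuleCat.ofHom e.symm.toLinearMap), ?_, ?_⟩
  · rw [hη]
    exact ModFl.Hom.ext (Category.comp_id (X := h) (𝟙 h))
      (AddMonoidHom.ext fun x => e.symm_apply_apply x)
  · rw [hη]
    exact ModFl.Hom.ext (Category.comp_id (X := h) (𝟙 h))
      (AddMonoidHom.ext fun x => e.apply_symm_apply x)

/-- An arrow of `mod^fl` over the identity, as a linear map. -/
lemma ModFl.exists_linearMap_of_base_eq {M N : ModuleCat.{u} h.R} (hM : modFlat h.h.hom M)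
    (hN : modFlat h.h.hom N) (η : ModFl.mk h M hM ⟶ ModFl.mk h N hN)
    (hbase : ModFl.Hom.base η = AlgFl.Hom.id h) :
    ∃ f : M →ₗ[h.R] N, ∀ x : M, ModFl.Hom.map η x = f x :=
  ⟨{ (ModFl.Hom.map η : M →+ N) with
      map_smul' := fun x m => by
        refine (ModFl.Hom.map_smul η x m).trans ?_
        rw [hbase]
        rfl }, fun _ => rfl⟩

lemma isRightMinimal_ofHom {M N : ModuleCat.{u} h.R} (hM : modFlat h.h.hom M)
    (hN : modFlat h.h.hom N) (p : M ⟶ N)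
    (H : ∀ f : M →ₗ[h.R] M, p.hom ∘ₗ f = p.hom → Function.Bijective f) :
    IsRightMinimal (ModFl.ofHom hM hN p) := by
  intro η hη
  -- In the total category η could a priori move the base rings, but p lies over the identity, so
  -- compatibility with p forces η to do so as well.
  have hbase : ModFl.Hom.base η = AlgFl.Hom.id h :=
    (Category.comp_id (X := h) (Y := h) (ModFl.Hom.base η)).symm.trans (congrArg ModFl.Hom.base hη)
  obtain ⟨f, hf⟩ := ModFl.exists_linearMap_of_base_eq hM hM η hbase
  refine ModFl.isIso_of_bijective hM η f (H f ?_) hbase hf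
  ext x
  exact (congrArg p.hom (hf x)).symm.trans (congrArg (fun z => ModFl.Hom.map z x) hη)

lemma isLeftMinimal_ofHom {N L : ModuleCat.{u} h.R} (hN : modFlat h.h.hom N)
    (hL : modFlat h.h.hom L) (j : N ⟶ L)
    (H : ∀ f : L →ₗ[h.R] L, f ∘ₗ j.hom = j.hom → Function.Bijective f) :
    IsLeftMinimal (ModFl.ofHom hN hL j) := by
  intro η hη
  have hbase : ModFl.Hom.base η = AlgFl.Hom.id h :=
    (Category.id_comp (X := h) (Y := h) (ModFl.Hom.base η)).symm.trans (congrArg ModFl.Hom.base hη)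
  obtain ⟨f, hf⟩ := ModFl.exists_linearMap_of_base_eq hL hL η hbase
  refine ModFl.isIso_of_bijective hL η f (H f ?_) hbase hf
  ext x
  exact (hf (j.hom x)).symm.trans (congrArg (fun z => ModFl.Hom.map z x) hη)

end Isomorphisms

section FibreCategory

variable {R : Type u} [CommRing R]

lemma ModuleCat.isIso_of_bijective {M : ModuleCat.{u} R} (η : M ⟶ M)
    (h : Function.Bijective η.hom) : IsIso η :=
  (ConcreteCategory.isIso_iff_bijective η).2 h

lemma IsSES.hom_comp_eq_zero {L M N : ModuleCat.{u} R} {i : L →ₗ[R] M} {p : M →ₗ[R] N}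
    (h : IsSES i p) : ModuleCat.ofHom i ≫ ModuleCat.ofHom p = 0 := by
  ext x
  exact h.exact.apply_apply_eq_zero x

variable {S : Type u} [CommRing S] [IsNoetherianRing R] [IsLocalRing R] {h : S →+* R}
  {r s : ℕ} {N : ModuleCat.{u} R}

theorem exists_minimal_right_approx (hh : h.Flat) (hr : 1 < r) (hsr : s ≤ r)
    (hN : catY r s h N) : ∃ (L M : ModuleCat.{u} R) (i : L ⟶ M) (p : M ⟶ N) (w : i ≫ p = 0),
      IsSeqA r s h (ShortComplex.mk i p w) ∧ IsRightApprox (catX r h) p ∧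
        ∀ η : M →ₗ[R] M, p.hom ∘ₗ η = p.hom → Function.Bijective η := by
  let _ := h.toAlgebra
  have : Module.Flat S R := hh
  obtain ⟨L, M, i, p, hs, hL, hM, hmin⟩ :=
    (((catY_iff hh hr).1 hN).hasSeq hr).1.exists_minimal hr (by lia)
  refine ⟨L, M, ModuleCat.ofHom i, ModuleCat.ofHom p, hs.hom_comp_eq_zero,
    ⟨(shortExact_mk_iff _ _ _).2 hs, catP_iff.2 hL, catX_of_inX hM⟩,
    ⟨catX_of_inX hM, fun M' φ hM' => ?_⟩, hmin⟩
  obtain ⟨ψ, hψ⟩ := ((catX_iff hh hr).1 hM').exists_lift hs hL (by lia) φ.hom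
  exact ⟨ModuleCat.ofHom ψ, ModuleCat.hom_ext hψ⟩

theorem exists_minimal_left_approx (hh : h.Flat) (hr : 1 < r) (hs : 1 < s) (hsr : s + 2 ≤ r)
    (hN : catY r s h N) : ∃ (L M : ModuleCat.{u} R) (j : N ⟶ L) (q : L ⟶ M) (w : j ≫ q = 0),
      IsSeqB r s h (ShortComplex.mk j q w) ∧ IsLeftApprox (catP (s - 1) h) j ∧
        ∀ θ : L →ₗ[R] L, θ ∘ₗ j.hom = j.hom → Function.Bijective θ := by
  let _ := h.toAlgebra
  have : Module.Flat S R := hh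
  obtain ⟨L, M, j, q, hs, hL, hM, hmin⟩ :=
    (((catY_iff hh hr).1 hN).hasSeq hr).2.exists_minimal (by lia) (by lia)
  refine ⟨L, M, ModuleCat.ofHom j, ModuleCat.ofHom q, hs.hom_comp_eq_zero,
    ⟨(shortExact_mk_iff _ _ _).2 hs, catP_iff.2 hL, catX_of_inX hM⟩,
    ⟨catP_iff.2 hL, fun L' φ hL' => ?_⟩, hmin⟩
  obtain ⟨ψ, hψ⟩ := hM.exists_extend hs (catP_iff.1 hL') (by lia) φ.hom
  exact ⟨ModuleCat.ofHom ψ, ModuleCat.hom_ext hψ⟩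

end FibreCategory

/-! ### Existence, finiteness and assembly -/

section Total

variable {h : AlgFl.{u}} {r s : ℕ} {N : ModuleCat.{u} h.R}

theorem exists_isStableSeqA (hr : 1 < r) (hN : catY r s h.h.hom N) :
    ∃ (L M : ModuleCat.{u} h.R) (i : L ⟶ M) (p : M ⟶ N) (w : i ≫ p = 0),
      IsStableSeqA r s h (ShortComplex.mk i p w) := by
  have := h.noeth_R
  let _ := h.h.hom.toAlgebra
  have : Module.Flat h.S h.R := h.flat
  obtain ⟨L, M, i, p, hs, hL, hM⟩ := (((catY_iff h.flat hr).1 hN).hasSeq hr).1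
  exact ⟨L, M, ModuleCat.ofHom i, ModuleCat.ofHom p, hs.hom_comp_eq_zero, isStableSeqA_of hr
    ⟨(shortExact_mk_iff _ _ _).2 hs, catP_iff.2 hL, catX_of_inX hM⟩ hN⟩

theorem exists_isStableSeqB (hr : 1 < r) (hN : catY r s h.h.hom N) :
    ∃ (L M : ModuleCat.{u} h.R) (j : N ⟶ L) (q : L ⟶ M) (w : j ≫ q = 0),
      IsStableSeqB r s h (ShortComplex.mk j q w) := by
  have := h.noeth_R
  let _ := h.h.hom.toAlgebra
  have : Module.Flat h.S h.R := h.flat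
  obtain ⟨L, M, j, q, hs, hL, hM⟩ := (((catY_iff h.flat hr).1 hN).hasSeq hr).2
  exact ⟨L, M, ModuleCat.ofHom j, ModuleCat.ofHom q, hs.hom_comp_eq_zero, isStableSeqB_of hr
    ((shortExact_mk_iff _ _ _).2 hs) (catP_iff.2 hL) hM hN⟩

theorem contravariantlyFinite_totX (hr : 1 < r) :
    ContravariantlyFinite (totX.{u} r) (totY r r) := by
  refine ⟨fun N hN => ?_, fun N hN => ?_⟩
  · have := N.alg.noeth_R
    let _ := N.alg.h.hom.toAlgebra
    exact (catY_iff N.alg.flat hr).2 (((catX_iff N.alg.flat hr).1 hN).inY (by lia))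
  · obtain ⟨L, M, i, p, w, hT⟩ := exists_isStableSeqA hr hN
    exact ⟨⟨N.alg, M, hT.1.1.2.2.1⟩, ModFl.ofHom _ N.prop p,
      isRightApprox_of_isSeqA hr le_rfl N.prop hT.1.1.2.2.1 hT.1.1⟩

theorem covariantlyFinite_totP (hr : 3 ≤ r) :
    CovariantlyFinite (totP.{u} (r - 3)) (totY r (r - 2)) := by
  refine ⟨fun N hN => ?_, fun N hN => ?_⟩
  · have := N.alg.noeth_R
    let _ := N.alg.h.hom.toAlgebra
    have : Module.Flat N.alg.S N.alg.R := N.alg.flat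
    exact (catY_iff N.alg.flat (by lia)).2 ((catP_iff.1 hN).inY (by lia))
  · obtain ⟨L, M, j, q, w, hT⟩ := exists_isStableSeqB (by lia) hN
    -- With `s = r - 2` the bound `s - 1` on the projective dimension is `r - 3`.
    have hL : catP (r - 3) N.alg.h.hom L := hT.1.1.2.1
    exact ⟨⟨N.alg, L, hL.1⟩, ModFl.ofHom N.prop _ j, isLeftApprox_of_isSeqB (by lia) (by lia)
      N.prop hL.1 ((shortExact_mk_iff _ _ _).1 hT.1.1.1) hL hT.1.1.2.2⟩

end Total

end

end FlatApprox

theorem mainTheorem4 :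
    -- (i) existence of the two base change stable short exact sequences
    (∀ (h : AlgFl.{u}) (r s : ℕ), 1 < r → 1 < s → ∀ N : ModuleCat.{u} h.R, catY r s h.h.hom N →
      (∃ (L M : ModuleCat.{u} h.R) (i : L ⟶ M) (p : M ⟶ N) (w : i ≫ p = 0),
        IsStableSeqA r s h (ShortComplex.mk i p w)) ∧
      (∃ (L' M' : ModuleCat.{u} h.R) (j : N ⟶ L') (q : L' ⟶ M') (w : j ≫ q = 0),
        IsStableSeqB r s h (ShortComplex.mk j q w))) ∧
    -- (ii) every such sequence is an approximation
    (∀ (h : AlgFl.{u}) (r s : ℕ), 1 < r → 1 < s →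
      ∀ (N : ModuleCat.{u} h.R) (_ : catY r s h.h.hom N) (hN : modFlat h.h.hom N),
      (s ≤ r → ∀ (L M : ModuleCat.{u} h.R) (hM : modFlat h.h.hom M)
        (i : L ⟶ M) (p : M ⟶ N) (w : i ≫ p = 0),
        IsSeqA r s h.h.hom (ShortComplex.mk i p w) →
          IsRightApprox (totX r) (ModFl.ofHom hM hN p)) ∧
      (s + 2 ≤ r → ∀ (L' M' : ModuleCat.{u} h.R) (hL' : modFlat h.h.hom L')
        (j : N ⟶ L') (q : L' ⟶ M') (w : j ≫ q = 0),
        IsSeqB r s h.h.hom (ShortComplex.mk j q w) →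
          IsLeftApprox (totP (s - 1)) (ModFl.ofHom hN hL' j))) ∧
    -- (iii) contravariant and covariant finiteness
    (∀ r : ℕ, 1 < r → ContravariantlyFinite (totX.{u} r) (totY r r)) ∧
    (∀ r : ℕ, 3 ≤ r → CovariantlyFinite (totP.{u} (r - 3)) (totY r (r - 2))) ∧
    -- (iv) minimal approximations for a local `h` in `Alg^fl`
    (∀ h : AlgFl.{u}, IsLocalRing h.S → IsLocalRing h.R → IsLocalHom h.h.hom →
      ∀ r s : ℕ, 1 < r → 1 < s →
      ∀ (N : ModuleCat.{u} h.R) (_ : catY r s h.h.hom N) (hN : modFlat h.h.hom N),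
      (s ≤ r → ∃ (L M : ModuleCat.{u} h.R) (hM : modFlat h.h.hom M)
        (i : L ⟶ M) (p : M ⟶ N) (w : i ≫ p = 0),
        IsStableSeqA r s h (ShortComplex.mk i p w) ∧
          IsRightApprox (totX r) (ModFl.ofHom hM hN p) ∧
          IsRightMinimal (ModFl.ofHom hM hN p)) ∧
      (s + 2 ≤ r → ∃ (L' M' : ModuleCat.{u} h.R) (hL' : modFlat h.h.hom L')
        (j : N ⟶ L') (q : L' ⟶ M') (w : j ≫ q = 0),
        IsStableSeqB r s h (ShortComplex.mk j q w) ∧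
          IsLeftApprox (totP (s - 1)) (ModFl.ofHom hN hL' j) ∧
          IsLeftMinimal (ModFl.ofHom hN hL' j))) ∧
    -- (iv), for any flat local homomorphism of noetherian local rings, in the fibre category
    (∀ (S R : Type u) [CommRing S] [CommRing R] [IsNoetherianRing S] [IsNoetherianRing R]
      [IsLocalRing S] [IsLocalRing R] (h : S →+* R), IsLocalHom h → h.Flat →
      ∀ r s : ℕ, 1 < r → 1 < s → ∀ N : ModuleCat.{u} R, catY r s h N →
      (s ≤ r → ∃ (L M : ModuleCat.{u} R) (i : L ⟶ M) (p : M ⟶ N) (w : i ≫ p = 0),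
        IsSeqA r s h (ShortComplex.mk i p w) ∧
          IsRightApprox (catX r h) p ∧ IsRightMinimal p) ∧
      (s + 2 ≤ r → ∃ (L' M' : ModuleCat.{u} R) (j : N ⟶ L') (q : L' ⟶ M') (w : j ≫ q = 0),
        IsSeqB r s h (ShortComplex.mk j q w) ∧
          IsLeftApprox (catP (s - 1) h) j ∧ IsLeftMinimal j)) := by
  refine ⟨fun h r s hr hs N hN => ⟨exists_isStableSeqA hr hN, exists_isStableSeqB hr hN⟩,
    fun h r s hr hs N _ hN => ⟨fun hsr L M hM i p w hT => isRightApprox_of_isSeqA hr hsr hN hM hT,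
      fun hsr L M hL j q w hT => isLeftApprox_of_isSeqB (by lia) (by lia) hN hL
        ((shortExact_mk_iff _ _ _).1 hT.1) hT.2.1 hT.2.2⟩,
    fun r hr => contravariantlyFinite_totX hr, fun r hr => covariantlyFinite_totP hr, ?_, ?_⟩
  · intro h _ _ _ r s hr hs N hY hN
    have := h.noeth_R
    constructor
    · intro hsr
      -- Only the sequence and its minimality among linear maps are kept; the approximation property
      -- is proved anew in the total category, where test objects may live over other bases.
      obtain ⟨L, M, i, p, w, hT, -, hmin⟩ := exists_minimal_right_approx h.flat hr hsr hY
      exact ⟨L, M, hT.2.2.1, i, p, w, isStableSeqA_of hr hT hY,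
        isRightApprox_of_isSeqA hr hsr hN _ hT, isRightMinimal_ofHom _ hN p hmin⟩
    · intro hsr
      obtain ⟨L, M, j, q, w, hT, -, hmin⟩ := exists_minimal_left_approx h.flat hr hs hsr hY
      exact ⟨L, M, hT.2.1.1, j, q, w, isStableSeqB_of hr hT.1 hT.2.1
        ((catX_iff h.flat (by lia)).1 hT.2.2) hY,
        isLeftApprox_of_isSeqB (by lia) (by lia) hN _ ((shortExact_mk_iff _ _ _).1 hT.1) hT.2.1
          hT.2.2, isLeftMinimal_ofHom hN _ j hmin⟩
  · intro S R _ _ _ _ _ _ h _ hh r s hr hs N hN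
    constructor
    · intro hsr
      obtain ⟨L, M, i, p, w, hT, hA, hmin⟩ := exists_minimal_right_approx hh hr hsr hN
      exact ⟨L, M, i, p, w, hT, hA, fun η hη =>
        ModuleCat.isIso_of_bijective η (hmin η.hom (congrArg ModuleCat.Hom.hom hη))⟩
    · intro hsr
      obtain ⟨L, M, j, q, w, hT, hA, hmin⟩ := exists_minimal_left_approx hh hr hs hsr hN
      exact ⟨L, M, j, q, w, hT, hA, fun η hη =>
        ModuleCat.isIso_of_bijective η (hmin η.hom (congrArg ModuleCat.Hom.hom hη))⟩
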